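/- Setting. Let $n,d\ge 1$, $V=\{1,\dots,n\}$. For $i\in V$ let $f_i,g_i:\mathbb R\to\mathbb R$ be convex, $X_i\subset\mathbb R$ convex and compact, and $A_0,A_i$ real symmetric $d\times d$ matrices. Put $X=\prod_i X_i$, $f(x)=\sum_i f_i(x_i)$, and let $f^*$ be the minimum of $f(x)$ over $x\in X$ subject to $\sum_i g_i(x_i)\le 0$ and $A_0+\sum_i x_iA_i\succeq 0$. Assume there is a Slater vector $\bar x\in X$, i.e. $\sum_i g_i(\bar x_i)<0$ and $A_0+\sum_i\bar x_iA_i\succ0$. For $\mu\ge0$, $G\succeq 0$ let $$L_i(t,\mu,G)=f_i(t)+\mu g_i(t)-\mathrm{tr}[(A_0/n+tA_i)G],\qquad q(\mu,G)=\min_{x\in X}\sum_{i}L_i(x_i,\mu,G).$$ Let $\gamma=\min\{-\sum_i g_i(\bar x_i),\ \lambda_{\min}(A_0+\sum_i\bar x_iA_i)\}$, pick any $\tilde\mu\ge 0$, $\tilde G\succeq0$ and $r>0$ with $r\ge (f(\bar x)-q(\tilde\mu,\tilde G))/\gamma$, and put $R=(f(\bar x)-q(\tilde\mu,\tilde G))/\gamma+r$,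 $D_\mu=\{\mu\ge0:|\mu|\le R\}$, $D_G=\{G\succeq0:\|G\|_F\le R\}$. Let $W\in\mathbb R^{n\times n}$ be symmetric, with $W_{ij}=0$ whenever $j\ne i$ is not a neighbour of $i$ in a given undirected communication graph on $V$, with $W\mathbf 1=\mathbf 1$, and with spectral radius $\rho[W-\mathbf 1\mathbf 1^{\mathsf T}/n]\le\nu$, where $0<\nu<1$. Let $\alpha>0$ and $\varphi\in\mathbb N$. Consensus-based dual decomposition (CoBa-DD) starts from any $\mu_i^0\ge0$, $G_i^0\succeq0$ and computes for $k\ge0$ $$\tilde x_i^k\in\arg\min_{t\in X_i}L_i(t,\mu_i^k,G_i^k),\quad \mu_i^{k+1}=\mathsf P_{D_\mu}\Big[\sum_j[W^\varphi]_{ij}(\mu_j^k+\alpha g_j(\tilde x_j^k))\Big],\quad G_i^{k+1}=\mathsf P_{D_G}\Big[\sum_j[W^\varphi]_{ij}(G_j^k-\alpha(A_0/n+\tilde x_j^kA_j))\Big],$$ where $\mathsf P$ is the Euclidean (Frobenius) projection, and, for $k\ge1$, the ergodic primal iterate $x_i^k=\frac1k\sum_{t=1}^k\tilde x_i^t$.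 Constants. $L=\max_{i}\max_{t\in X_i}|g_i(t)|$, $Q=\max_i\max_{t\in X_i}\|A_0/n+tA_i\|_F$, $M=L+Q$. $\Lambda$ and $\Gamma$ are finite bounds with $|\mu|\le\Lambda$ for all $\mu\in D_\mu$ and $\|G\|_F\le\Gamma$ for all $G\in D_G$ (so $|\mu_i^k|\le\Lambda$ and $\|G_i^k\|_F\le\Gamma$ for all $i$ and $k\ge1$). $\beta_0>0$ satisfies, for all $i\in V$, $$\Big|\sum_j[W^\varphi-\tfrac1n\mathbf 1\mathbf 1^{\mathsf T}]_{ij}(\mu_j^0+\alpha g_j(\tilde x_j^0))\Big|+\Big\|\sum_j[W^\varphi-\tfrac1n\mathbf 1\mathbf 1^{\mathsf T}]_{ij}(G_j^0-\alpha(A_0/n+\tilde x_j^0A_j))\Big\|_F\le\beta_0 .$$ $\tau$ satisfies $\beta_0/\alpha\le\tau$, and $\zeta>0$ is such that for every $z\in Z:=D_\mu\times D_G$, every subgradient $h$ of the concave function $q|_Z$ at $z$ and every $v\in\mathbb R\times\mathbb R^{d\times d}$ of Euclidean norm at most $\tau$, the vector $h+v$ is a $\zeta$-subgradient of $q|_Z$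 at $z$, where $h$ is an $\epsilon$-subgradient at $z$ if $\langle h,y-z\rangle\ge q(y)-q(z)-\epsilon$ for all $y\in Z$ (and a subgradient if this holds with $\epsilon=0$). Theorem. If $\varphi\ge\bar\varphi+\delta$ for some $\delta\ge0$, where $$\bar\varphi=\frac{\log\beta_0-\log(4n(1+d^2)(\beta_0+\alpha M))}{\log\nu},$$ then for every $k\ge1$ $$f^*-\frac{9(\Lambda^2+\Gamma^2)}{2k\alpha/n}-e_k\ \le\ f(x^k)\ \le\ f^*+\frac{\Lambda^2+\Gamma^2}{2k\alpha/n}+e_k,$$ $$e_k=\frac{\alpha n(M+\tau)^2}{2}+n\tau(\Lambda+\Gamma)+n\big(\beta_0(6M+3\tau)+\zeta\big).$$ -/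

import Mathlib

open scoped Matrix

attribute [local instance] Matrix.frobeniusNormedAddCommGroup

noncomputable section

namespace CoBaDD

/-- Real `d × d` matrices; in this file `‖·‖` on them is the Frobenius norm. -/
abbrev Mat (d : ℕ) := Matrix (Fin d) (Fin d) ℝ

/-- Data of the problem: minimize `∑ i, f i (x i)` over `x i ∈ X i` subject to
`∑ i, g i (x i) ≤ 0` and `A₀ + ∑ i, x i • A i ⪰ 0`. -/
structure Problem (n d : ℕ) where
  f : Fin n → ℝ → ℝ
  g : Fin n → ℝ → ℝ
  A₀ : Mat d
  A : Fin n → Mat d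
  X : Fin n → Set ℝ

namespace Problem

variable {n d : ℕ} (P : Problem n d)

/-- Convex costs and constraints, convex compact local sets, symmetric matrices. -/
structure IsConvexCompact : Prop where
  f_convex : ∀ i, ConvexOn ℝ Set.univ (P.f i)
  g_convex : ∀ i, ConvexOn ℝ Set.univ (P.g i)
  X_convex : ∀ i, Convex ℝ (P.X i)
  X_compact : ∀ i, IsCompact (P.X i)
  A₀_symm : P.A₀.IsSymm
  A_symm : ∀ i, (P.A i).IsSymm

/-- The product set `X = ∏ i, X i`. -/
def box : Set (Fin n → ℝ) := {x | ∀ i, x i ∈ P.X i}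

/-- The cost `f(x) = ∑ i, f i (x i)`. -/
def cost (x : Fin n → ℝ) : ℝ := ∑ i, P.f i (x i)

/-- The left-hand side of the scalar constraint. -/
def ineq (x : Fin n → ℝ) : ℝ := ∑ i, P.g i (x i)

/-- The left-hand side of the linear matrix inequality. -/
def lmi (x : Fin n → ℝ) : Mat d := P.A₀ + ∑ i, x i • P.A i

/-- The feasible set. -/
def feasible : Set (Fin n → ℝ) :=
  {x | x ∈ P.box ∧ P.ineq x ≤ 0 ∧ (P.lmi x).PosSemidef}

/-- The optimal value `f*`. -/
def optValue : ℝ := sInf (P.cost '' P.feasible)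

/-- A strictly feasible (Slater) vector. -/
def IsSlater (x : Fin n → ℝ) : Prop :=
  x ∈ P.box ∧ P.ineq x < 0 ∧ (P.lmi x).PosDef

/-- The Lagrangian `L(x, μ, G)`. -/
def lagrangian (x : Fin n → ℝ) (μ : ℝ) (G : Mat d) : ℝ :=
  P.cost x + μ * P.ineq x - (P.lmi x * G).trace

/-- The dual function `q(μ, G) = min_{x ∈ X} L(x, μ, G)`. -/
def dual (μ : ℝ) (G : Mat d) : ℝ :=
  sInf ((fun x => P.lagrangian x μ G) '' P.box)

/-- The local matrix constraint function `A₀ / n + t A i`. -/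
def localLmi (i : Fin n) (t : ℝ) : Mat d := (1 / (n : ℝ)) • P.A₀ + t • P.A i

/-- The local Lagrangian `L_i(t, μ, G)`. -/
def localLagrangian (i : Fin n) (t μ : ℝ) (G : Mat d) : ℝ :=
  P.f i t + μ * P.g i t - (P.localLmi i t * G).trace

/-- `L`, the maximum of `|g_i(t)|` over all nodes `i` and all `t ∈ X i`. -/
def boundL : ℝ := sSup {y | ∃ i, ∃ t ∈ P.X i, y = ‖P.g i t‖}

/-- `Q`, the maximum of `‖-A₀ / n - t A i‖_F` over all nodes `i` and all `t ∈ X i`. -/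
def boundQ : ℝ := sSup {y | ∃ i, ∃ t ∈ P.X i, y = ‖-P.localLmi i t‖}

/-- `M = L + Q`. -/
def boundM : ℝ := P.boundL + P.boundQ

/-- Smallest eigenvalue of a (symmetric) matrix. -/
def lambdaMin (S : Mat d) : ℝ := sInf (spectrum ℝ S)

/-- `γ = min {-∑ i, g_i(x̄_i), λ_min (A₀ + ∑ i, x̄_i A_i)}`. -/
def slaterMargin (xbar : Fin n → ℝ) : ℝ :=
  min (-P.ineq xbar) (lambdaMin (P.lmi xbar))

/-- `(f(x̄) - q(μ̃, G̃)) / γ`. -/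
def dualBound (xbar : Fin n → ℝ) (μt : ℝ) (Gt : Mat d) : ℝ :=
  (P.cost xbar - P.dual μt Gt) / P.slaterMargin xbar

end Problem

/-- The set `D_μ` with radius `R`. -/
def Dmu (R : ℝ) : Set ℝ := {μ | 0 ≤ μ ∧ ‖μ‖ ≤ R}

/-- The set `D_G` with radius `R`. -/
def DG (d : ℕ) (R : ℝ) : Set (Mat d) := {G | G.PosSemidef ∧ ‖G‖ ≤ R}

/-- `p` is the projection of `v` onto `C`: the point of `C` nearest to `v`. -/
def IsProj {E : Type*} [NormedAddCommGroup E] (C : Set E) (v p : E) : Prop :=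
  p ∈ C ∧ ∀ c ∈ C, ‖v - p‖ ≤ ‖v - c‖

/-- The averaging matrix `1 1ᵀ / n`. -/
def avgMatrix (n : ℕ) : Matrix (Fin n) (Fin n) ℝ := Matrix.of fun _ _ => 1 / (n : ℝ)

/-- `W` is a consensus matrix for the communication graph `N` with bound `ν` on the
spectral radius of `W - 1 1ᵀ / n`. -/
structure IsConsensusMatrix {n : ℕ} (N : SimpleGraph (Fin n))
    (W : Matrix (Fin n) (Fin n) ℝ) (ν : ℝ) : Prop where
  sparse : ∀ i j, j ≠ i → ¬ N.Adj i j → W i j = 0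
  symm : W.IsSymm
  mulVec_one : W *ᵥ 1 = 1
  radius_le : spectralRadius ℝ (W - avgMatrix n) ≤ ENNReal.ofReal ν
  ν_lt_one : ν < 1

/-- The sequences `μ k i`, `G k i` (local dual variables) and `xt k i` (local minimizers) are
generated by consensus-based dual decomposition with consensus matrix `W`, `φ` consensus steps,
stepsize `α` and projection sets `D_μ`, `D_G` of radius `R`. -/
structure IsRun {n d : ℕ} (P : Problem n d) (W : Matrix (Fin n) (Fin n) ℝ) (φ : ℕ) (α R : ℝ)
    (μ : ℕ → Fin n → ℝ) (G : ℕ → Fin n → Mat d) (xt : ℕ → Fin n → ℝ) : Prop where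
  init_μ : ∀ i, 0 ≤ μ 0 i
  init_G : ∀ i, (G 0 i).PosSemidef
  xt_mem : ∀ k i, xt k i ∈ P.X i
  xt_min : ∀ k i, ∀ t ∈ P.X i,
    P.localLagrangian i (xt k i) (μ k i) (G k i) ≤ P.localLagrangian i t (μ k i) (G k i)
  step_μ : ∀ k i, IsProj (Dmu R)
    (∑ j, (W ^ φ) i j * (μ k j + α * P.g j (xt k j))) (μ (k + 1) i)
  step_G : ∀ k i, IsProj (DG d R)
    (∑ j, (W ^ φ) i j • (G k j - α • P.localLmi j (xt k j))) (G (k + 1) i)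

/-- The ergodic primal iterate `x_i^k = (1/k) ∑_{t=1}^k x̃_i^t`. -/
def ergodic {n : ℕ} (xt : ℕ → Fin n → ℝ) (k : ℕ) (i : Fin n) : ℝ :=
  (1 / (k : ℝ)) * ∑ t ∈ Finset.Icc 1 k, xt t i

/-- The initial disagreement at node `i` after the first `φ` consensus steps. -/
def initialDisagreement {n d : ℕ} (P : Problem n d) (W : Matrix (Fin n) (Fin n) ℝ) (φ : ℕ)
    (α : ℝ) (μ₀ : Fin n → ℝ) (G₀ : Fin n → Mat d) (xt₀ : Fin n → ℝ) (i : Fin n) : ℝ :=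
  ‖∑ j, (W ^ φ - avgMatrix n) i j * (μ₀ j + α * P.g j (xt₀ j))‖ +
    ‖∑ j, (W ^ φ - avgMatrix n) i j • (G₀ j - α • P.localLmi j (xt₀ j))‖

/-- The threshold `φ̄` on the number of consensus steps. -/
def consensusThreshold (n d : ℕ) (ν α M β₀ : ℝ) : ℝ :=
  (Real.log β₀ - Real.log (4 * n * (1 + (d : ℝ) ^ 2) * (β₀ + α * M))) / Real.log ν

/-- Euclidean inner product of pairs `(μ, G)`, seen as vectors of length `1 + d²`. -/
def pairInner {d : ℕ} (a b : ℝ × Mat d) : ℝ := a.1 * b.1 + (a.2ᵀ * b.2).trace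

/-- Euclidean norm of a pair `(μ, G)`, seen as a vector of length `1 + d²`. -/
def pairNorm {d : ℕ} (a : ℝ × Mat d) : ℝ := Real.sqrt (pairInner a a)

/-- `h` is an `ε`-subgradient at `z` of the concave function `q` on the set `Z`. -/
def IsEpsSubgradient {d : ℕ} (Z : Set (ℝ × Mat d)) (q : ℝ × Mat d → ℝ) (ε : ℝ)
    (z h : ℝ × Mat d) : Prop :=
  ∀ y ∈ Z, q y - q z - ε ≤ pairInner h (y - z)

/-- Every subgradient of `q` on `Z`, perturbed by a vector of norm at most `τ`, is a
`ζ`-subgradient. -/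
def IsPerturbationBound {d : ℕ} (Z : Set (ℝ × Mat d)) (q : ℝ × Mat d → ℝ) (τ ζ : ℝ) : Prop :=
  ∀ z ∈ Z, ∀ h, IsEpsSubgradient Z q 0 z h →
    ∀ v, pairNorm v ≤ τ → IsEpsSubgradient Z q ζ z (h + v)

/-- The error floor `e_k` (which does not depend on `k`). -/
def errorFloor (n : ℕ) (α M τ Λ Γ β₀ ζ : ℝ) : ℝ :=
  α * n * (M + τ) ^ 2 / 2 + n * τ * (Λ + Γ) + n * (β₀ * (6 * M + 3 * τ) + ζ)

end CoBaDD

end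

noncomputable section

attribute [local instance] Matrix.frobeniusNormedSpace

namespace CoBaDD

/-! The method is an inexact projected supergradient ascent on the dual function, followed through
the network averages of the multipliers. `W ^ φ - avgMatrix n` has zero row and column sums and
entries of size at most `ν ^ φ`; the threshold on `φ` makes these so small that a disagreement of at
most `β₀` reproduces itself (`IsRun.disagreement_le`). All local multipliers then stay within `2 *
β₀` of their average, so the local minimizers together minimize the Lagrangian at the average up to
`4 * n * β₀ * M` (`IsRun.lagrangian_mean_le`).

Nonexpansive projections give a descent inequality for the squared distance to any fixed point `θ`
of the projection sets (`IsRun.sum_dist_sq_le`). Telescoped, it bounds the average of `⟨s_t, z_t -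
θ⟩` from below, where `z_t` is the average multiplier and `s_t` the pair of constraint value and
negated LMI value at the local minimizers. With `θ = 0`, weak duality and Jensen's inequality give
the upper bound on the cost.

For the lower bound take `θ = 2 z*` with `z*` an optimal multiplier, which exists by Slater's
condition (`Problem.exists_dual_optimal`). The saddle inequalities give `⟨s_t, z_t - z*⟩ ≤ ε` for
the Lagrangian error `ε`, hence `⟨s_t, z*⟩ ≤ ε - ⟨s_t, z_t - 2 z*⟩`. This controls the penalty in
the Lagrangian at the ergodic point. The radius `R` is large enough to contain `2 z*`. -/

/-! ### Frobenius inner product and semidefinite matrices -/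

lemma mat_norm_sq {d : ℕ} (A : Mat d) : ‖A‖ ^ 2 = (Aᵀ * A).trace := by
  rw [Matrix.frobenius_norm_def, ← Real.sqrt_eq_rpow, Real.sq_sqrt (by positivity)]
  simp only [Matrix.trace, Matrix.diag, Matrix.mul_apply, Matrix.transpose_apply]
  rw [Finset.sum_comm]
  refine Finset.sum_congr rfl fun i _ => Finset.sum_congr rfl fun j _ => ?_
  simp [sq]

/-- The Frobenius inner product on real matrices. -/
@[reducible] def matInner (d : ℕ) : InnerProductSpace ℝ (Mat d) where
  inner A B := (Aᵀ * B).trace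
  norm_sq_eq_re_inner A := mat_norm_sq A
  conj_inner_symm A B := by
    simp only [conj_trivial]
    rw [← Matrix.trace_transpose, Matrix.transpose_mul, Matrix.transpose_transpose]
  add_left A B C := by simp [Matrix.add_mul]
  smul_left A B r := by simp

attribute [local instance] matInner

lemma mat_inner_eq {d : ℕ} (A B : Mat d) : inner ℝ A B = (Aᵀ * B).trace := rfl

open scoped MatrixOrder in
lemma PosSemidef.trace_mul_nonneg {d : ℕ} {A B : Mat d} (hA : A.PosSemidef) (hB : B.PosSemidef) :
    0 ≤ (A * B).trace := by
  obtain ⟨C, rfl⟩ := CStarAlgebra.nonneg_iff_eq_star_mul_self.mp hB.nonneg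
  have h := (hA.mul_mul_conjTranspose_same C).trace_nonneg
  rw [Matrix.star_eq_conjTranspose, ← mul_assoc, Matrix.trace_mul_comm, ← mul_assoc]
  exact h

open scoped MatrixOrder in
lemma PosSemidef.norm_le_trace {d : ℕ} {A : Mat d} (hA : A.PosSemidef) : ‖A‖ ≤ A.trace := by
  obtain ⟨C, rfl⟩ := CStarAlgebra.nonneg_iff_eq_star_mul_self.mp hA.nonneg
  have h := Matrix.frobenius_norm_mul Cᴴ C
  rw [Matrix.frobenius_norm_conjTranspose, ← sq, mat_norm_sq] at h
  simpa [Matrix.star_eq_conjTranspose] using h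

lemma norm_vecMulVec_self {d : ℕ} (v : Fin d → ℝ) : ‖Matrix.vecMulVec v v‖ = v ⬝ᵥ v := by
  have h0 : 0 ≤ v ⬝ᵥ v := by simpa using dotProduct_star_self_nonneg v
  rw [← sq_eq_sq₀ (norm_nonneg _) h0, mat_norm_sq, Matrix.transpose_vecMulVec,
    Matrix.vecMulVec_mul_vecMulVec, Matrix.trace_vecMulVec, dotProduct_smul, smul_eq_mul, sq]

lemma trace_mul_vecMulVec_self {d : ℕ} (A : Mat d) (v : Fin d → ℝ) :
    (A * Matrix.vecMulVec v v).trace = v ⬝ᵥ (A *ᵥ v) := by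
  rw [Matrix.mul_vecMulVec, Matrix.trace_vecMulVec, dotProduct_comm]

/-- By Cauchy–Schwarz, `vᵀ E v = ⟨E, v vᵀ⟩ ≤ ‖E‖ (vᵀ v)`. -/
lemma posSemidef_smul_one_sub {d : ℕ} {E : Mat d} {s : ℝ} (hE : E.IsSymm) (h : ‖E‖ ≤ s) :
    (s • (1 : Mat d) - E).PosSemidef := by
  refine Matrix.PosSemidef.of_dotProduct_mulVec_nonneg ?_ fun v => ?_
  · simp only [Matrix.IsHermitian, Matrix.conjTranspose_eq_transpose_of_trivial,
      Matrix.transpose_sub, Matrix.transpose_smul, Matrix.transpose_one, hE.eq]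
  · have h0 : 0 ≤ v ⬝ᵥ v := by simpa using dotProduct_star_self_nonneg v
    have h1 := real_inner_le_norm E (Matrix.vecMulVec v v)
    rw [mat_inner_eq, hE.eq, trace_mul_vecMulVec_self, norm_vecMulVec_self] at h1
    simp only [star_trivial, Matrix.sub_mulVec, Matrix.smul_mulVec, Matrix.one_mulVec,
      dotProduct_sub, dotProduct_smul, smul_eq_mul]
    nlinarith

lemma lambdaMin_le_eigenvalues {d : ℕ} {S : Mat d} (hS : S.IsHermitian) (i : Fin d) :
    Problem.lambdaMin S ≤ hS.eigenvalues i := by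
  unfold Problem.lambdaMin
  rw [hS.spectrum_real_eq_range_eigenvalues]
  exact csInf_le (Set.finite_range _).bddBelow ⟨i, rfl⟩

lemma lambdaMin_pos {d : ℕ} (hd : 0 < d) {S : Mat d} (hS : S.PosDef) :
    0 < Problem.lambdaMin S := by
  -- For `d = 0` the spectrum is empty and `sInf ∅ = 0`, so positivity would fail.
  have : Nonempty (Fin d) := ⟨⟨0, hd⟩⟩
  unfold Problem.lambdaMin
  rw [hS.isHermitian.spectrum_real_eq_range_eigenvalues]
  obtain ⟨i, hi⟩ := (Set.range_nonempty hS.isHermitian.eigenvalues).csInf_mem (Set.finite_range _)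
  rw [← hi]
  exact hS.eigenvalues_pos i

lemma posSemidef_sub_lambdaMin {d : ℕ} {S : Mat d} (hS : S.IsHermitian) :
    (S - Problem.lambdaMin S • (1 : Mat d)).PosSemidef := by
  have hH : (S - Problem.lambdaMin S • (1 : Mat d)).IsHermitian := by
    refine hS.sub ?_
    simp [Matrix.IsHermitian]
  rw [hH.posSemidef_iff_eigenvalues_nonneg]
  intro i
  have h := hH.eigenvalues_mem_spectrum_real i
  have h2 : hH.eigenvalues i + Problem.lambdaMin S ∈ spectrum ℝ S := by
    have := spectrum.add_mem_add_iff (R := ℝ) (a := S - Problem.lambdaMin S • (1 : Mat d))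
      (r := hH.eigenvalues i) (s := Problem.lambdaMin S)
    have h' := this.mpr h
    rwa [Algebra.algebraMap_eq_smul_one, add_sub_cancel] at h'
  rw [hS.spectrum_real_eq_range_eigenvalues] at h2
  obtain ⟨j, hj⟩ := h2
  have := lambdaMin_le_eigenvalues hS j
  simp only [Pi.zero_apply]
  linarith

lemma lambdaMin_mul_trace_le {d : ℕ} {S G : Mat d} (hS : S.IsHermitian) (hG : G.PosSemidef) :
    Problem.lambdaMin S * G.trace ≤ (S * G).trace := by
  have h := PosSemidef.trace_mul_nonneg (posSemidef_sub_lambdaMin hS) hG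
  simp only [Matrix.sub_mul, Matrix.smul_mul, Matrix.one_mul, Matrix.trace_sub,
    Matrix.trace_smul, smul_eq_mul] at h
  linarith

/-! ### Powers of the consensus matrix -/

/-- In an orthonormal eigenbasis the entry is `∑ λ_l ^ m U_il U_jl`; each eigenvalue has modulus at
most `ν` and the rows of `U` are unit vectors. -/
lemma abs_pow_apply_le_of_spectralRadius_le {n : ℕ} {B : Matrix (Fin n) (Fin n) ℝ} {ν : ℝ}
    (hν : 0 ≤ ν) (hB : B.IsSymm) (h : spectralRadius ℝ B ≤ ENNReal.ofReal ν) (m : ℕ)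
    (i j : Fin n) : |(B ^ m) i j| ≤ ν ^ m := by
  have hH : B.IsHermitian := by
    rw [Matrix.IsHermitian, Matrix.conjTranspose_eq_transpose_of_trivial, hB.eq]
  have hev : ∀ l, |hH.eigenvalues l| ≤ ν := fun l => by
    have h1 : (‖hH.eigenvalues l‖₊ : ENNReal) ≤ spectralRadius ℝ B :=
      le_iSup₂ (f := fun k (_ : k ∈ spectrum ℝ B) => (‖k‖₊ : ENNReal)) _
        (hH.eigenvalues_mem_spectrum_real l)
    have h2 := h1.trans h
    rwa [← enorm_eq_nnnorm, ← ofReal_norm, ENNReal.ofReal_le_ofReal_iff hν, Real.norm_eq_abs] at h2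
  set U : Matrix (Fin n) (Fin n) ℝ := (hH.eigenvectorUnitary).1 with hU
  have hUU : U * Uᴴ = 1 := Unitary.mul_star_self_of_mem hH.eigenvectorUnitary.2
  have hpow : B ^ m = U * Matrix.diagonal (fun l => hH.eigenvalues l ^ m) * Uᴴ := by
    conv_lhs => rw [hH.spectral_theorem, ← map_pow, Unitary.conjStarAlgAut_apply]
    simp [Matrix.diagonal_pow, hU, Matrix.star_eq_conjTranspose]
    rfl
  have hrow : ∀ a, ∑ l, U a l ^ 2 = 1 := fun a => by
    have := congrFun (congrFun hUU a) a
    simpa [Matrix.mul_apply, sq] using this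
  have hent : (B ^ m) i j = ∑ l, hH.eigenvalues l ^ m * (U i l * U j l) := by
    rw [hpow, Matrix.mul_apply]
    refine Finset.sum_congr rfl fun l _ => ?_
    simp [Matrix.mul_diagonal]
    ring
  rw [hent]
  calc |∑ l, hH.eigenvalues l ^ m * (U i l * U j l)|
      ≤ ∑ l, |hH.eigenvalues l ^ m * (U i l * U j l)| := Finset.abs_sum_le_sum_abs _ _
    _ ≤ ∑ l, ν ^ m * ((U i l ^ 2 + U j l ^ 2) / 2) := by
        refine Finset.sum_le_sum fun l _ => ?_
        rw [abs_mul, abs_pow]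
        have h3 : |U i l * U j l| ≤ (U i l ^ 2 + U j l ^ 2) / 2 := by
          rw [abs_le]
          constructor <;> nlinarith [sq_nonneg (U i l + U j l), sq_nonneg (U i l - U j l)]
        exact mul_le_mul (pow_le_pow_left₀ (abs_nonneg _) (hev l) m) h3 (abs_nonneg _)
          (pow_nonneg hν m)
    _ = ν ^ m := by
        rw [← Finset.mul_sum, ← Finset.sum_div, Finset.sum_add_distrib, hrow, hrow]
        ring

section Averaging

variable {n : ℕ} {W : Matrix (Fin n) (Fin n) ℝ}

lemma avgMatrix_mul_avgMatrix (hn : 0 < n) : avgMatrix n * avgMatrix n = avgMatrix n := by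
  have : (n : ℝ) ≠ 0 := by positivity
  ext i j
  simp [avgMatrix, Matrix.mul_apply]
  field_simp

lemma mul_avgMatrix (hW : W *ᵥ 1 = 1) : W * avgMatrix n = avgMatrix n := by
  ext i j
  have := congrFun hW i
  simp only [Matrix.mulVec, dotProduct, Pi.one_apply, mul_one] at this
  simp [avgMatrix, Matrix.mul_apply, ← Finset.sum_mul, this]

lemma avgMatrix_isSymm (n : ℕ) : (avgMatrix n).IsSymm := by
  ext i j
  simp [avgMatrix]

lemma avgMatrix_mul (hs : W.IsSymm) (hW : W *ᵥ 1 = 1) : avgMatrix n * W = avgMatrix n := by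
  have := congrArg Matrix.transpose (mul_avgMatrix hW)
  rwa [Matrix.transpose_mul, hs.eq, (avgMatrix_isSymm n).eq] at this

/-- `avgMatrix n` is idempotent and absorbs `W` on both sides, so the cross terms collapse. Exponent
`0` is excluded, since there the left side is `1 - avgMatrix n` and the right side is `1`. -/
lemma pow_sub_avgMatrix (hn : 0 < n) (hs : W.IsSymm) (hW : W *ᵥ 1 = 1) {m : ℕ} (hm : m ≠ 0) :
    W ^ m - avgMatrix n = (W - avgMatrix n) ^ m := by
  obtain ⟨m, rfl⟩ := Nat.exists_eq_succ_of_ne_zero hm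
  clear hm
  have hp : ∀ m, W ^ m * avgMatrix n = avgMatrix n := fun m => by
    induction m with
    | zero => simp
    | succ m ih => rw [pow_succ, Matrix.mul_assoc, mul_avgMatrix hW, ih]
  induction m with
  | zero => simp
  | succ m ih =>
    rw [pow_succ (W - avgMatrix n), ← ih, Matrix.sub_mul, Matrix.mul_sub, Matrix.mul_sub, hp,
      avgMatrix_mul hs hW, avgMatrix_mul_avgMatrix hn, pow_succ W (m + 1)]
    simp

lemma sum_pow_sub_avgMatrix_row (hn : 0 < n) (hW : W *ᵥ 1 = 1) (m : ℕ) (i : Fin n) :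
    ∑ j, (W ^ m - avgMatrix n) i j = 0 := by
  have hp : ∀ m, (W ^ m) *ᵥ 1 = 1 := fun m => by
    induction m with
    | zero => simp
    | succ m ih => rw [pow_succ, ← Matrix.mulVec_mulVec, hW, ih]
  have h := congrFun (hp m) i
  simp only [Matrix.mulVec, dotProduct, Pi.one_apply, mul_one] at h
  have : (n : ℝ) ≠ 0 := by positivity
  simp [avgMatrix, Finset.sum_sub_distrib, h]
  field_simp
  simp

lemma sum_pow_sub_avgMatrix_col (hn : 0 < n) (hs : W.IsSymm) (hW : W *ᵥ 1 = 1) (m : ℕ)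
    (j : Fin n) : ∑ i, (W ^ m - avgMatrix n) i j = 0 := by
  rw [← sum_pow_sub_avgMatrix_row hn hW m j]
  refine Finset.sum_congr rfl fun i _ => ?_
  have h : (W ^ m - avgMatrix n).IsSymm := by
    unfold Matrix.IsSymm
    rw [Matrix.transpose_sub, Matrix.transpose_pow, hs.eq, (avgMatrix_isSymm n).eq]
  exact h.apply j i

end Averaging

/-! ### Projections and averages in an inner product space -/

section Hilbert

variable {H : Type*} [NormedAddCommGroup H] [InnerProductSpace ℝ H]

lemma IsProj.inner_nonpos {C : Set H} (hC : Convex ℝ C) {v p : H} (hp : IsProj C v p) {θ : H}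
    (hθ : θ ∈ C) : inner ℝ (v - p) (θ - p) ≤ 0 := by
  refine (norm_eq_iInf_iff_real_inner_le_zero hC hp.1).1 ?_ θ hθ
  have : Nonempty C := ⟨⟨p, hp.1⟩⟩
  refine le_antisymm (le_ciInf fun w => hp.2 w w.2) ?_
  exact ciInf_le (f := fun w : C => ‖v - w‖)
    ⟨0, by rintro _ ⟨w, rfl⟩; exact norm_nonneg _⟩ ⟨p, hp.1⟩

lemma IsProj.norm_sub_sq_le {C : Set H} (hC : Convex ℝ C) {v p : H} (hp : IsProj C v p) {θ : H}
    (hθ : θ ∈ C) : ‖p - θ‖ ^ 2 ≤ ‖v - θ‖ ^ 2 := by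
  have h := hp.inner_nonpos hC hθ
  have h1 : v - θ = (v - p) - (θ - p) := by abel
  rw [h1, norm_sub_sq_real (v - p), norm_sub_rev p θ]
  nlinarith [sq_nonneg ‖v - p‖]

lemma IsProj.norm_sub_le {C : Set H} (hC : Convex ℝ C) {v w p q : H} (hp : IsProj C v p)
    (hq : IsProj C w q) : ‖p - q‖ ≤ ‖v - w‖ := by
  have h1 := hp.inner_nonpos hC hq.1
  have h2 := hq.inner_nonpos hC hp.1
  have h3 : ‖p - q‖ ^ 2 ≤ inner ℝ (v - w) (p - q) := by
    have e1 : q - p = -(p - q) := by abel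
    have e2 : v - w = (v - p) - (w - q) + (p - q) := by abel
    rw [e1, inner_neg_right] at h1
    rw [e2, inner_add_left, inner_sub_left, real_inner_self_eq_norm_sq]
    linarith
  have h4 := real_inner_le_norm (v - w) (p - q)
  by_contra h
  push Not at h
  nlinarith [norm_nonneg (v - w)]

lemma sum_norm_add_sq {n : ℕ} (e : Fin n → H) (he : ∑ i, e i = 0) (w : H) :
    ∑ i, ‖e i + w‖ ^ 2 = ∑ i, ‖e i‖ ^ 2 + n * ‖w‖ ^ 2 := by
  simp only [norm_add_sq_real, Finset.sum_add_distrib, ← Finset.mul_sum, ← sum_inner, he]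
  simp

/-- The average of a finite family. -/
def mean {n : ℕ} (z : Fin n → H) : H := (1 / (n : ℝ)) • ∑ i, z i

lemma smul_mean {n : ℕ} (hn : 0 < n) (z : Fin n → H) : (n : ℝ) • mean z = ∑ i, z i := by
  have : (n : ℝ) ≠ 0 := by positivity
  rw [mean, smul_smul, mul_one_div_cancel this, one_smul]

lemma sum_sub_mean {n : ℕ} (hn : 0 < n) (z : Fin n → H) : ∑ i, (z i - mean z) = 0 := by
  rw [Finset.sum_sub_distrib, ← smul_mean hn z]
  simp [← Nat.cast_smul_eq_nsmul ℝ]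

lemma card_mul_norm_mean_sub_sq_le {n : ℕ} (hn : 0 < n) (z : Fin n → H) (θ : H) :
    n * ‖mean z - θ‖ ^ 2 ≤ ∑ i, ‖z i - θ‖ ^ 2 := by
  have h := sum_norm_add_sq (fun i => z i - mean z) (sum_sub_mean hn z) (mean z - θ)
  simp only [sub_add_sub_cancel] at h
  rw [h]
  have : 0 ≤ ∑ i, ‖z i - mean z‖ ^ 2 := Finset.sum_nonneg fun i _ => by positivity
  linarith

lemma norm_sub_mean_le {n : ℕ} (hn : 0 < n) (z : Fin n → H) (i : Fin n) :
    ‖z i - mean z‖ ≤ (1 / (n : ℝ)) * ∑ j, ‖z i - z j‖ := by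
  have h0 : (n : ℝ) ≠ 0 := by positivity
  have h : z i - mean z = (1 / (n : ℝ)) • ∑ j, (z i - z j) := by
    rw [Finset.sum_sub_distrib, smul_sub, mean]
    simp [← Nat.cast_smul_eq_nsmul ℝ, smul_smul, h0]
  rw [h, norm_smul, Real.norm_of_nonneg (by positivity)]
  gcongr
  exact norm_sum_le _ _

/-- Zero-sum weights do not see constants, so the family may be recentred at any `c`; only its
spread matters. -/
lemma norm_sum_smul_le {n : ℕ} {B : Fin n → ℝ} {b : ℝ} (hB : ∀ j, |B j| ≤ b) (hs : ∑ j, B j = 0)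
    (u : Fin n → H) (c : H) : ‖∑ j, B j • u j‖ ≤ b * ∑ j, ‖u j - c‖ := by
  have h : ∑ j, B j • u j = ∑ j, B j • (u j - c) := by
    simp [smul_sub, Finset.sum_sub_distrib, ← Finset.sum_smul, hs]
  rw [h, Finset.mul_sum]
  refine (norm_sum_le _ _).trans (Finset.sum_le_sum fun j _ => ?_)
  rw [norm_smul, Real.norm_eq_abs]
  exact mul_le_mul_of_nonneg_right (hB j) (norm_nonneg _)

lemma sum_smul_eq_add_mean {n : ℕ} (V : Matrix (Fin n) (Fin n) ℝ) (u : Fin n → H) (i : Fin n) :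
    ∑ j, V i j • u j = ∑ j, (V - avgMatrix n) i j • u j + mean u := by
  simp [avgMatrix, sub_smul, Finset.sum_sub_distrib, ← Finset.smul_sum, mean]

/-- One step of the consensus-based projected ascent method, measured from a point `θ` of the
projection set. -/
lemma sum_norm_proj_sub_sq_le {n : ℕ} (hn : 0 < n) {C : Set H} (hC : Convex ℝ C)
    {V : Matrix (Fin n) (Fin n) ℝ} (hV : ∀ j, ∑ i, (V - avgMatrix n) i j = 0) {α : ℝ}
    {z s z' : Fin n → H} (hz' : ∀ i, IsProj C (∑ j, V i j • (z j + α • s j)) (z' i))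
    {θ : H} (hθ : θ ∈ C) :
    ∑ i, ‖z' i - θ‖ ^ 2 ≤ ∑ i, ‖z i - θ‖ ^ 2 + 2 * α * inner ℝ (∑ j, s j) (mean z - θ)
      + n * α ^ 2 * ‖mean s‖ ^ 2
      + ∑ i, ‖∑ j, (V - avgMatrix n) i j • (z j + α • s j)‖ ^ 2 := by
  have hm : mean (fun j => z j + α • s j) = mean z + α • mean s := by
    simp only [mean, Finset.sum_add_distrib, ← Finset.smul_sum, smul_add]
    rw [smul_comm]
  set e : Fin n → H := fun i => ∑ j, (V - avgMatrix n) i j • (z j + α • s j) with he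
  -- Since the consensus errors sum to zero, they have no cross term with the common displacement
  -- and enter only through their squares.
  have he0 : ∑ i, e i = 0 := by
    simp only [he]
    rw [Finset.sum_comm]
    simp only [← Finset.sum_smul, hV, zero_smul, Finset.sum_const_zero]
  have h1 : ∀ i, ‖z' i - θ‖ ^ 2 ≤ ‖e i + (mean z - θ + α • mean s)‖ ^ 2 := fun i => by
    refine ((hz' i).norm_sub_sq_le hC hθ).trans_eq ?_
    rw [sum_smul_eq_add_mean, hm]
    congr 2
    simp only [he]
    abel
  have h2 := Finset.sum_le_sum fun i (_ : i ∈ Finset.univ) => h1 i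
  rw [sum_norm_add_sq e he0, norm_add_sq_real] at h2
  have h3 := card_mul_norm_mean_sub_sq_le hn z θ
  have h4 : inner ℝ (∑ j, s j) (mean z - θ) = n * inner ℝ (mean z - θ) (mean s) := by
    rw [← smul_mean hn s, inner_smul_left, real_inner_comm]
    simp
  rw [inner_smul_right, norm_smul, mul_pow, Real.norm_eq_abs, sq_abs] at h2
  rw [h4]
  linarith

end Hilbert

/-! ### Lagrangian and weak duality -/

namespace Problem

variable {n d : ℕ} {P : Problem n d}

lemma lmi_isSymm (hP : P.IsConvexCompact) (x : Fin n → ℝ) : (P.lmi x).IsSymm := by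
  unfold lmi Matrix.IsSymm
  rw [Matrix.transpose_add, hP.A₀_symm.eq, Matrix.transpose_sum]
  simp only [Matrix.transpose_smul, (hP.A_symm _).eq]

lemma continuous_f (hP : P.IsConvexCompact) (i : Fin n) : Continuous (P.f i) :=
  (hP.f_convex i).locallyLipschitz.continuous

lemma continuous_g (hP : P.IsConvexCompact) (i : Fin n) : Continuous (P.g i) :=
  (hP.g_convex i).locallyLipschitz.continuous

lemma isCompact_box (hP : P.IsConvexCompact) : IsCompact P.box := by
  have := isCompact_univ_pi hP.X_compact
  convert this using 1
  ext x
  simp [box]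

lemma convex_box (hP : P.IsConvexCompact) : Convex ℝ P.box := fun _ hx _ hy _ _ ha hb hab i =>
  hP.X_convex i (hx i) (hy i) ha hb hab

lemma convexOn_cost (hP : P.IsConvexCompact) : ConvexOn ℝ Set.univ P.cost :=
  ⟨convex_univ, fun x _ y _ a b ha hb hab => by
    simp only [cost, Finset.smul_sum, ← Finset.sum_add_distrib]
    exact Finset.sum_le_sum fun i _ =>
      (hP.f_convex i).2 (Set.mem_univ (x i)) (Set.mem_univ (y i)) ha hb hab⟩

lemma convexOn_ineq (hP : P.IsConvexCompact) : ConvexOn ℝ Set.univ P.ineq :=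
  ⟨convex_univ, fun x _ y _ a b ha hb hab => by
    simp only [ineq, Finset.smul_sum, ← Finset.sum_add_distrib]
    exact Finset.sum_le_sum fun i _ =>
      (hP.g_convex i).2 (Set.mem_univ (x i)) (Set.mem_univ (y i)) ha hb hab⟩

lemma lmi_combo (x y : Fin n → ℝ) {a b : ℝ} (hab : a + b = 1) :
    P.lmi (a • x + b • y) = a • P.lmi x + b • P.lmi y := by
  simp only [lmi, Pi.add_apply, Pi.smul_apply, smul_eq_mul, add_smul, smul_add, Finset.smul_sum,
    Finset.sum_add_distrib, mul_smul]
  have : P.A₀ = a • P.A₀ + b • P.A₀ := by rw [← add_smul, hab, one_smul]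
  nth_rewrite 1 [this]
  abel

lemma continuous_cost (hP : P.IsConvexCompact) : Continuous P.cost :=
  continuous_finsetSum _ fun i _ => (continuous_f hP i).comp (continuous_apply i)

lemma lmi_eq_sum_localLmi (hn : 0 < n) (x : Fin n → ℝ) :
    P.lmi x = ∑ i, P.localLmi i (x i) := by
  have h0 : (n : ℝ) ≠ 0 := by positivity
  simp [lmi, localLmi, Finset.sum_add_distrib, ← Nat.cast_smul_eq_nsmul ℝ, smul_smul, h0]

lemma lagrangian_eq_sum (hn : 0 < n) (x : Fin n → ℝ) (m : ℝ) (G : Mat d) :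
    P.lagrangian x m G = ∑ i, P.localLagrangian i (x i) m G := by
  simp only [lagrangian, localLagrangian, cost, ineq, lmi_eq_sum_localLmi hn, Finset.sum_sub_distrib,
    Finset.sum_add_distrib, Finset.mul_sum, Finset.sum_mul, Matrix.trace_sum]

lemma continuous_localLagrangian (hP : P.IsConvexCompact) (i : Fin n) (m : ℝ) (G : Mat d) :
    Continuous fun t => P.localLagrangian i t m G := by
  have h : ∀ t, (P.localLmi i t * G).trace
      = ((1 / (n : ℝ)) • P.A₀ * G).trace + t * (P.A i * G).trace := fun t => by
    simp [localLmi, Matrix.add_mul]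
  simp only [localLagrangian, h]
  exact ((continuous_f hP i).add (continuous_const.mul (continuous_g hP i))).sub
    (continuous_const.add (continuous_id.mul continuous_const))

lemma dual_le (hn : 0 < n) (hP : P.IsConvexCompact) {x : Fin n → ℝ} (hx : x ∈ P.box) (m : ℝ)
    (G : Mat d) : P.dual m G ≤ P.lagrangian x m G := by
  refine csInf_le ?_ ⟨x, hx, rfl⟩
  refine ((isCompact_box hP).image ?_).bddBelow
  simp only [lagrangian_eq_sum hn]
  exact continuous_finsetSum _ fun i _ =>
    (continuous_localLagrangian hP i m G).comp (continuous_apply i)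

lemma lagrangian_le_cost {x : Fin n → ℝ} (hx : x ∈ P.feasible) {m : ℝ} (hm : 0 ≤ m) {G : Mat d}
    (hG : G.PosSemidef) : P.lagrangian x m G ≤ P.cost x := by
  have h1 := mul_nonpos_of_nonneg_of_nonpos hm hx.2.1
  have h2 := PosSemidef.trace_mul_nonneg hx.2.2 hG
  unfold lagrangian
  linarith

lemma IsSlater.mem_feasible {x : Fin n → ℝ} (hx : P.IsSlater x) : x ∈ P.feasible :=
  ⟨hx.1, hx.2.1.le, hx.2.2.posSemidef⟩

lemma optValue_le (hP : P.IsConvexCompact) {x : Fin n → ℝ} (hx : x ∈ P.feasible) :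
    P.optValue ≤ P.cost x := by
  refine csInf_le ?_ ⟨x, hx, rfl⟩
  exact ((isCompact_box hP).image (continuous_cost hP)).bddBelow.mono
    (Set.image_mono fun x hx => hx.1)

lemma le_optValue {xbar : Fin n → ℝ} (hx : P.IsSlater xbar) {c : ℝ}
    (h : ∀ x ∈ P.feasible, c ≤ P.cost x) : c ≤ P.optValue := by
  refine le_csInf ⟨_, xbar, hx.mem_feasible, rfl⟩ ?_
  rintro _ ⟨x, hx, rfl⟩
  exact h x hx

end Problem

/-! ### Strong duality under Slater's condition -/

/-- This cone, a union of balls centred at `-s • 1`, replaces the negative definite matrices, which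
are not open among all matrices. Its symmetric members are negative definite. -/
lemma isOpen_negCone (d : ℕ) : IsOpen {C : Mat d | ∃ s : ℝ, 0 < s ∧ ‖C + s • (1 : Mat d)‖ < s} := by
  have : {C : Mat d | ∃ s : ℝ, 0 < s ∧ ‖C + s • (1 : Mat d)‖ < s}
      = ⋃ s : ℝ, {C : Mat d | 0 < s ∧ ‖C + s • (1 : Mat d)‖ < s} := by
    ext C
    simp
  rw [this]
  refine isOpen_iUnion fun s => ?_
  by_cases hs : 0 < s
  · simp only [hs, true_and]
    exact isOpen_lt (by fun_prop) continuous_const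
  · simp [hs]

lemma convex_negCone (d : ℕ) :
    Convex ℝ {C : Mat d | ∃ s : ℝ, 0 < s ∧ ‖C + s • (1 : Mat d)‖ < s} := by
  rintro C ⟨s, hs, hC⟩ D ⟨t, ht, hD⟩ a b ha hb hab
  have hpos : 0 < a * s + b * t := by
    rcases ha.eq_or_lt with rfl | ha
    · have : b = 1 := by linarith
      subst this
      simpa using ht
    · have := mul_pos ha hs
      have := mul_nonneg hb ht.le
      linarith
  refine ⟨a * s + b * t, hpos, ?_⟩
  have h : a • C + b • D + (a * s + b * t) • (1 : Mat d)
      = a • (C + s • (1 : Mat d)) + b • (D + t • (1 : Mat d)) := by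
    rw [add_smul, mul_smul, mul_smul, smul_add, smul_add]
    abel
  rw [h]
  refine (norm_add_le _ _).trans_lt ?_
  rw [norm_smul, norm_smul, Real.norm_of_nonneg ha, Real.norm_of_nonneg hb]
  rcases ha.eq_or_lt with rfl | ha
  · have : b = 1 := by linarith
    subst this
    simpa using hD
  · have := mul_lt_mul_of_pos_left hC ha
    have := mul_le_mul_of_nonneg_left hD.le hb
    linarith

/-- A linear functional that is nonnegative on the positive semidefinite cone is represented, on
symmetric matrices, by a positive semidefinite matrix. -/
lemma exists_posSemidef_repr {d : ℕ} (Φ : Mat d →ₗ[ℝ] ℝ)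
    (hΦ : ∀ S : Mat d, S.PosSemidef → 0 ≤ Φ S) :
    ∃ G : Mat d, G.PosSemidef ∧ ∀ C : Mat d, C.IsSymm → Φ C = (C * G).trace := by
  set F : Mat d := Matrix.of fun i j => Φ (Matrix.single i j 1) with hF
  have hrep : ∀ C : Mat d, Φ C = (Cᵀ * F).trace := fun C => by
    conv_lhs => rw [Matrix.matrix_eq_sum_single C]
    simp only [map_sum, Matrix.trace, Matrix.diag, Matrix.mul_apply, Matrix.transpose_apply]
    rw [Finset.sum_comm]
    refine Finset.sum_congr rfl fun i _ => Finset.sum_congr rfl fun j _ => ?_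
    have : Matrix.single j i (C j i) = C j i • (Matrix.single j i 1 : Mat d) := by simp
    rw [this, map_smul, smul_eq_mul]
    rfl
  have hsymm : ∀ C : Mat d, C.IsSymm → Φ C = (C * ((1 / 2 : ℝ) • (F + Fᵀ))).trace := by
    intro C hC
    have h1 := hrep C
    have h2 : (C * Fᵀ).trace = Φ C := by
      rw [h1, ← Matrix.trace_transpose, Matrix.transpose_mul, Matrix.transpose_transpose,
        Matrix.trace_mul_comm]
    rw [hC.eq] at h1
    rw [Matrix.mul_smul, Matrix.mul_add, Matrix.trace_smul, Matrix.trace_add, h2, ← h1,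
      smul_eq_mul]
    ring
  -- `F` need not be symmetric, but its symmetric part gives the same trace against symmetric
  -- matrices; testing `Φ` on `v vᵀ` shows that this part is positive semidefinite.
  refine ⟨(1 / 2 : ℝ) • (F + Fᵀ), ?_, hsymm⟩
  refine Matrix.PosSemidef.of_dotProduct_mulVec_nonneg ?_ fun v => ?_
  · rw [Matrix.IsHermitian, Matrix.conjTranspose_eq_transpose_of_trivial, Matrix.transpose_smul,
      Matrix.transpose_add, Matrix.transpose_transpose, add_comm]
  · have hv : (Matrix.vecMulVec v v).PosSemidef := by
      simpa using Matrix.posSemidef_vecMulVec_self_star v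
    rw [star_trivial, ← trace_mul_vecMulVec_self, Matrix.trace_mul_comm,
      ← hsymm _ (by rw [Matrix.IsSymm, Matrix.transpose_vecMulVec])]
    exact hΦ _ hv

lemma nonneg_of_forall_le_add_mul {u c l : ℝ} (h : ∀ t : ℝ, 0 ≤ t → u ≤ c + t * l) : 0 ≤ l := by
  by_contra hl
  push Not at hl
  have h0 := h 0 le_rfl
  -- This `t` would make the right-hand side equal to `u - 1`.
  have h1 := h ((c - u + 1) / (-l)) (div_nonneg (by linarith) (by linarith))
  have : (c - u + 1) / (-l) * l = -(c - u + 1) := by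
    have : l ≠ 0 := hl.ne
    field_simp
  linarith

/-- Strong duality: under the Slater condition an optimal multiplier exists. -/
theorem Problem.exists_dual_optimal {n d : ℕ} (hd : 0 < d) {P : Problem n d}
    (hP : P.IsConvexCompact) {xbar : Fin n → ℝ} (hx : P.IsSlater xbar) :
    ∃ (m : ℝ) (G : Mat d), 0 ≤ m ∧ G.PosSemidef ∧
      ∀ x ∈ P.box, P.optValue ≤ P.lagrangian x m G := by
  set S : Set (ℝ × ℝ × Mat d) := {p | ∃ x ∈ P.box, P.cost x - P.optValue ≤ p.1 ∧
    P.ineq x ≤ p.2.1 ∧ (p.2.2 + P.lmi x).PosSemidef} with hS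
  set T : Set (ℝ × ℝ × Mat d) := Set.Iio 0 ×ˢ Set.Iio 0 ×ˢ
    {C : Mat d | ∃ s : ℝ, 0 < s ∧ ‖C + s • (1 : Mat d)‖ < s} with hT
  have hTo : IsOpen T := isOpen_Iio.prod (isOpen_Iio.prod (isOpen_negCone d))
  have hTc : Convex ℝ T := (convex_Iio 0).prod ((convex_Iio 0).prod (convex_negCone d))
  have hSc : Convex ℝ S := by
    rintro p ⟨x, hx, h1, h2, h3⟩ q ⟨y, hy, k1, k2, k3⟩ a b ha hb hab
    refine ⟨a • x + b • y, P.convex_box hP hx hy ha hb hab, ?_, ?_, ?_⟩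
    · have := (P.convexOn_cost hP).2 (Set.mem_univ x) (Set.mem_univ y) ha hb hab
      simp only [smul_eq_mul, Prod.fst_add, Prod.smul_fst] at this ⊢
      have e : P.optValue = a * P.optValue + b * P.optValue := by rw [← add_mul, hab, one_mul]
      nlinarith [mul_le_mul_of_nonneg_left h1 ha, mul_le_mul_of_nonneg_left k1 hb]
    · have := (P.convexOn_ineq hP).2 (Set.mem_univ x) (Set.mem_univ y) ha hb hab
      simp only [smul_eq_mul, Prod.snd_add, Prod.smul_snd, Prod.fst_add, Prod.smul_fst] at this ⊢
      nlinarith [mul_le_mul_of_nonneg_left h2 ha, mul_le_mul_of_nonneg_left k2 hb]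
    · have := (h3.smul ha).add (k3.smul hb)
      rw [Problem.lmi_combo x y hab]
      simp only [Prod.snd_add, Prod.smul_snd]
      convert this using 1
      rw [smul_add, smul_add]
      abel
  have hdisj : Disjoint T S := by
    rw [Set.disjoint_left]
    rintro p ⟨h1, h2, s, hs, h3⟩ ⟨x, hx, k1, k2, k3⟩
    -- Membership in `S` forces `p.2.2` to be symmetric, so on the intersection the open cone yields
    -- genuine negative definiteness and `x` is feasible with cost below `optValue`.
    have hsym : (p.2.2 + s • (1 : Mat d)).IsSymm := by
      have e1 : (p.2.2 + P.lmi x).IsSymm := by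
        have := k3.isHermitian
        rwa [Matrix.IsHermitian, Matrix.conjTranspose_eq_transpose_of_trivial] at this
      have e2 : p.2.2 + s • (1 : Mat d) = (p.2.2 + P.lmi x) - P.lmi x + s • (1 : Mat d) := by abel
      rw [e2]
      exact (e1.sub (P.lmi_isSymm hP x)).add (Matrix.isSymm_one.smul s)
    have hpsd := k3.add (posSemidef_smul_one_sub hsym h3.le)
    have e : p.2.2 + P.lmi x + (s • (1 : Mat d) - (p.2.2 + s • (1 : Mat d))) = P.lmi x := by abel
    rw [e] at hpsd
    have hf := P.optValue_le hP (x := x) ⟨hx, k2.trans (le_of_lt h2), hpsd⟩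
    have : p.1 < 0 := h1
    linarith
  obtain ⟨φ, u, hTu, hSu⟩ := geometric_hahn_banach_open hTc hTo hSc hdisj
  set l0 : ℝ := φ (1, 0, 0) with hl0
  set l1 : ℝ := φ (0, 1, 0) with hl1
  set Φ : Mat d →ₗ[ℝ] ℝ := φ.toLinearMap ∘ₗ LinearMap.inr ℝ ℝ (ℝ × Mat d) ∘ₗ
    LinearMap.inr ℝ ℝ (Mat d) with hΦ
  have hφ : ∀ a b C, φ (a, b, C) = a * l0 + b * l1 + Φ C := fun a b C => by
    have : ((a, b, C) : ℝ × ℝ × Mat d) = a • (1, 0, 0) + b • (0, 1, 0) + (0, 0, C) := by simp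
    rw [this, map_add, map_add, map_smul, map_smul]
    rfl
  -- `T` contains points `(-t, -t, -t • 1)` arbitrarily close to the origin.
  have hu : 0 ≤ u := by
    have h : ∀ t : ℝ, 0 < t → -(t * (l0 + l1 + Φ 1)) < u := fun t ht => by
      have := hTu (-t, -t, -t • (1 : Mat d)) ⟨by simpa using ht, by simpa using ht, t, ht, by
        simpa using ht⟩
      rw [hφ, map_smul, smul_eq_mul] at this
      linarith
    by_contra hneg
    push Not at hneg
    rcases le_or_gt (l0 + l1 + Φ 1) 0 with hK | hK
    · have := h 1 one_pos
      linarith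
    · have := h (-u / (l0 + l1 + Φ 1)) (div_pos (by linarith) hK)
      rw [div_mul_cancel₀ _ hK.ne'] at this
      linarith
  have hSx : ∀ x ∈ P.box, ∀ a b C, 0 ≤ a → 0 ≤ b → Matrix.PosSemidef C →
      u ≤ (P.cost x - P.optValue) * l0 + P.ineq x * l1 - Φ (P.lmi x) + a * l0 + b * l1 + Φ C := by
    intro x hx a b C ha hb hC
    have := hSu (P.cost x - P.optValue + a, P.ineq x + b, -P.lmi x + C)
      ⟨x, hx, by simpa using ha, by simpa using hb, by
        have e : -P.lmi x + C + P.lmi x = C := by abel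
        simpa [e] using hC⟩
    rw [hφ, map_add, map_neg] at this
    linarith
  have hl0n : 0 ≤ l0 := nonneg_of_forall_le_add_mul (u := u)
    (c := (P.cost xbar - P.optValue) * l0 + P.ineq xbar * l1 - Φ (P.lmi xbar)) fun t ht => by
      have := hSx xbar hx.1 t 0 0 ht le_rfl Matrix.PosSemidef.zero
      simpa using this
  have hl1n : 0 ≤ l1 := nonneg_of_forall_le_add_mul (u := u)
    (c := (P.cost xbar - P.optValue) * l0 + P.ineq xbar * l1 - Φ (P.lmi xbar)) fun t ht => by
      have := hSx xbar hx.1 0 t 0 le_rfl ht Matrix.PosSemidef.zero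
      simpa using this
  have hΦn : ∀ C : Mat d, C.PosSemidef → 0 ≤ Φ C := fun C hC => nonneg_of_forall_le_add_mul (u := u)
    (c := (P.cost xbar - P.optValue) * l0 + P.ineq xbar * l1 - Φ (P.lmi xbar)) fun t ht => by
      have := hSx xbar hx.1 0 0 (t • C) le_rfl le_rfl (hC.smul ht)
      simpa using this
  -- If `l0 = 0`, then `u ≥ 0` at the Slater point forces `l1 = 0` and `Φ 1 = 0`; the point `(-1,
  -- -1, -1)` of `T` then gives `0 < u`, while the Slater point gives `u ≤ 0`.
  have hl0p : 0 < l0 := by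
    refine hl0n.lt_of_ne' fun h0 => ?_
    have hlam := lambdaMin_pos hd hx.2.2
    have h1 := hΦn _ (posSemidef_sub_lambdaMin hx.2.2.isHermitian)
    rw [map_sub, map_smul, smul_eq_mul] at h1
    have h2 := hΦn 1 Matrix.PosSemidef.one
    have h3 := hSx xbar hx.1 0 0 0 le_rfl le_rfl Matrix.PosSemidef.zero
    rw [h0, map_zero] at h3
    have h4 := hTu (-1, -1, -(1 : Mat d)) ⟨by simp, by simp, 1, one_pos, by simp⟩
    rw [hφ, h0, map_neg] at h4
    have h5 := hx.2.1
    have h6 : P.ineq xbar * l1 ≤ 0 := mul_nonpos_of_nonpos_of_nonneg h5.le hl1n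
    have h7 : 0 ≤ lambdaMin (P.lmi xbar) * Φ 1 := mul_nonneg hlam.le h2
    have h8 : P.ineq xbar * l1 = 0 := by linarith
    have h9 : lambdaMin (P.lmi xbar) * Φ 1 = 0 := by linarith
    have h10 : l1 = 0 := (mul_eq_zero.mp h8).resolve_left h5.ne
    have h11 : Φ 1 = 0 := (mul_eq_zero.mp h9).resolve_left hlam.ne'
    rw [h10, h11] at h4
    linarith
  obtain ⟨G, hG, hrep⟩ := exists_posSemidef_repr (l0⁻¹ • Φ) fun C hC =>
    mul_nonneg (inv_nonneg.mpr hl0n) (hΦn C hC)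
  refine ⟨l0⁻¹ * l1, G, mul_nonneg (inv_nonneg.mpr hl0n) hl1n, hG, fun x hx => ?_⟩
  have h := hSx x hx 0 0 0 le_rfl le_rfl Matrix.PosSemidef.zero
  have h2 := hrep _ (P.lmi_isSymm hP x)
  simp only [LinearMap.smul_apply, smul_eq_mul] at h2
  unfold lagrangian
  rw [← h2]
  have h3 : 0 ≤ (P.cost x - P.optValue) * l0 + P.ineq x * l1 - Φ (P.lmi x) := by
    rw [map_zero] at h
    linarith
  have h4 := mul_nonneg (inv_nonneg.mpr hl0n) h3
  have h5 : l0⁻¹ * ((P.cost x - P.optValue) * l0 + P.ineq x * l1 - Φ (P.lmi x))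
      = P.cost x - P.optValue + l0⁻¹ * l1 * P.ineq x - l0⁻¹ * Φ (P.lmi x) := by
    field_simp
  linarith

/-! ### Projection sets and bounds on gradients and multipliers -/

lemma convex_Dmu (R : ℝ) : Convex ℝ (Dmu R) := by
  have : Dmu R = Set.Ici 0 ∩ Metric.closedBall 0 R := by
    ext x
    simp [Dmu]
  rw [this]
  exact (convex_Ici 0).inter (convex_closedBall 0 R)

lemma convex_DG (d : ℕ) (R : ℝ) : Convex ℝ (DG d R) := by
  intro A hA B hB a b ha hb hab
  refine ⟨(hA.1.smul ha).add (hB.1.smul hb), ?_⟩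
  have h : Convex ℝ (Metric.closedBall (0 : Mat d) R) := convex_closedBall 0 R
  simpa using h (by simpa using hA.2) (by simpa using hB.2) ha hb hab

lemma two_smul_mem_DG {d : ℕ} {R : ℝ} {S : Mat d} (hS : S.PosSemidef) (h : 2 * ‖S‖ ≤ R) :
    (2 : ℝ) • S ∈ DG d R := by
  refine ⟨hS.smul zero_le_two, ?_⟩
  rwa [norm_smul, Real.norm_of_nonneg zero_le_two]

lemma mean_mem {H : Type*} [AddCommGroup H] [Module ℝ H] {n : ℕ} (hn : 0 < n) {C : Set H}
    (hC : Convex ℝ C) {z : Fin n → H} (hz : ∀ i, z i ∈ C) : (1 / (n : ℝ)) • ∑ i, z i ∈ C := by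
  have h0 : (n : ℝ) ≠ 0 := by positivity
  rw [Finset.smul_sum]
  exact hC.sum_mem (fun _ _ => by positivity) (by simp [h0]) fun i _ => hz i

lemma norm_mean_le {H : Type*} [NormedAddCommGroup H] [InnerProductSpace ℝ H] {n : ℕ}
    (hn : 0 < n) {s : Fin n → H} {c : ℝ} (h : ∀ i, ‖s i‖ ≤ c) : ‖mean s‖ ≤ c := by
  have h1 := mean_mem hn (convex_closedBall (0 : H) c) (z := s) fun i => by simpa using h i
  simpa [mean] using h1

namespace Problem

variable {n d : ℕ} {P : Problem n d}

lemma bddAbove_range_of_continuous (hP : P.IsConvexCompact) {h : Fin n → ℝ → ℝ}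
    (hc : ∀ i, Continuous (h i)) : BddAbove {y | ∃ i, ∃ t ∈ P.X i, y = h i t} := by
  have e : {y | ∃ i, ∃ t ∈ P.X i, y = h i t} = ⋃ i, h i '' P.X i := by
    ext y
    simp [eq_comm]
  rw [e]
  exact (isCompact_iUnion fun i => (hP.X_compact i).image (hc i)).bddAbove

lemma norm_g_le_boundL (hP : P.IsConvexCompact) {i : Fin n} {t : ℝ} (ht : t ∈ P.X i) :
    ‖P.g i t‖ ≤ P.boundL :=
  le_csSup (bddAbove_range_of_continuous hP fun i => (continuous_g hP i).norm) ⟨i, t, ht, rfl⟩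

lemma norm_neg_localLmi_le_boundQ (hP : P.IsConvexCompact) {i : Fin n} {t : ℝ} (ht : t ∈ P.X i) :
    ‖-P.localLmi i t‖ ≤ P.boundQ := by
  refine le_csSup (bddAbove_range_of_continuous hP (h := fun i t => ‖-P.localLmi i t‖) fun i => ?_)
    ⟨i, t, ht, rfl⟩
  unfold localLmi
  fun_prop

lemma localLmi_isSymm (hP : P.IsConvexCompact) (i : Fin n) (t : ℝ) : (P.localLmi i t).IsSymm :=
  (hP.A₀_symm.smul _).add ((hP.A_symm i).smul _)

lemma abs_localLagrangian_sub_le (hP : P.IsConvexCompact) {i : Fin n} {t : ℝ} (ht : t ∈ P.X i)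
    {m m' b : ℝ} {G G' : Mat d} (h : ‖m - m'‖ + ‖G - G'‖ ≤ b) :
    |P.localLagrangian i t m G - P.localLagrangian i t m' G'| ≤ b * P.boundM := by
  have e : P.localLagrangian i t m G - P.localLagrangian i t m' G'
      = (m - m') * P.g i t + inner ℝ (-P.localLmi i t) (G - G') := by
    rw [mat_inner_eq, Matrix.transpose_neg, (localLmi_isSymm hP i t).eq]
    simp only [localLagrangian, Matrix.neg_mul, Matrix.mul_sub, Matrix.trace_neg,
      Matrix.trace_sub]
    ring
  have h1 := norm_g_le_boundL hP ht
  have h2 := norm_neg_localLmi_le_boundQ hP ht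
  have h3 : |(m - m') * P.g i t| ≤ ‖m - m'‖ * P.boundL := by
    rw [← Real.norm_eq_abs, norm_mul]
    exact mul_le_mul_of_nonneg_left h1 (norm_nonneg _)
  have h4 : |inner ℝ (-P.localLmi i t) (G - G')| ≤ P.boundQ * ‖G - G'‖ :=
    (abs_real_inner_le_norm _ _).trans (mul_le_mul_of_nonneg_right h2 (norm_nonneg _))
  have h5 : 0 ≤ P.boundL := (norm_nonneg _).trans h1
  have h6 : 0 ≤ P.boundQ := (norm_nonneg _).trans h2
  rw [e, boundM]
  refine (abs_add_le _ _).trans ?_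
  nlinarith [norm_nonneg (m - m'), norm_nonneg (G - G'),
    mul_le_mul_of_nonneg_right h (add_nonneg h5 h6), mul_nonneg (norm_nonneg (m - m')) h6,
    mul_nonneg (norm_nonneg (G - G')) h5]

/-- Multipliers at which the Lagrangian dominates the optimal value are bounded. -/
lemma add_norm_le_dualBound (hn : 0 < n) (hd : 0 < d) (hP : P.IsConvexCompact) {xbar : Fin n → ℝ}
    (hx : P.IsSlater xbar) {μt : ℝ} (hμt : 0 ≤ μt) {Gt : Mat d} (hGt : Gt.PosSemidef)
    {m : ℝ} {G : Mat d} (hm : 0 ≤ m) (hG : G.PosSemidef)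
    (hopt : ∀ x ∈ P.box, P.optValue ≤ P.lagrangian x m G) :
    m + ‖G‖ ≤ P.dualBound xbar μt Gt := by
  -- At the Slater point `optValue ≤ cost - γ (m + tr G)`; weak duality bounds `optValue` below by
  -- the dual value at `(μt, Gt)`.
  have hγ : 0 < P.slaterMargin xbar :=
    lt_min (by have := hx.2.1; linarith) (lambdaMin_pos hd hx.2.2)
  have h1 : P.dual μt Gt ≤ P.optValue := le_optValue hx fun x hx =>
    (dual_le hn hP hx.1 μt Gt).trans (lagrangian_le_cost hx hμt hGt)
  have h2 := hopt xbar hx.1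
  have h3 := lambdaMin_mul_trace_le hx.2.2.isHermitian hG
  have h4 : P.slaterMargin xbar ≤ -P.ineq xbar := min_le_left _ _
  have h5 : P.slaterMargin xbar ≤ lambdaMin (P.lmi xbar) := min_le_right _ _
  have h6 := PosSemidef.norm_le_trace hG
  unfold dualBound
  rw [le_div_iff₀ hγ]
  unfold lagrangian at h2
  nlinarith [mul_le_mul_of_nonneg_right h4 hm, mul_le_mul_of_nonneg_left h6 hγ.le,
    mul_le_mul_of_nonneg_right h5 ((norm_nonneg G).trans h6)]

end Problem

/-! ### Consensus error and dual descent along a run -/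

/-- The factor `n * (2 * β₀ + α * M)` bounds the summed spread of the values mixed in one round: `2
* β₀` from the multipliers and `α * M` from the gradient step, per node. -/
lemma pow_le_of_consensusThreshold_le {n d : ℕ} (hn : 0 < n) {ν α M β₀ : ℝ} (hν : 0 < ν)
    (hν1 : ν < 1) (hα : 0 < α) (hM : 0 ≤ M) (hβ₀ : 0 < β₀) {φ : ℕ}
    (h : consensusThreshold n d ν α M β₀ ≤ φ) :
    φ ≠ 0 ∧ ν ^ φ * (n * (2 * β₀ + α * M)) ≤ β₀ := by
  have hn1 : (1 : ℝ) ≤ n := by exact_mod_cast hn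
  have hαM : 0 ≤ α * M := by positivity
  set D : ℝ := 4 * n * (1 + (d : ℝ) ^ 2) * (β₀ + α * M) with hD
  have hK : (1 : ℝ) ≤ n * (1 + (d : ℝ) ^ 2) := by nlinarith [sq_nonneg (d : ℝ)]
  have hDge : n * (4 * (β₀ + α * M)) ≤ D := by
    rw [hD]
    have := mul_nonneg (mul_nonneg (by positivity : (0 : ℝ) ≤ n) (sq_nonneg (d : ℝ)))
      (by positivity : 0 ≤ β₀ + α * M)
    nlinarith
  have hDp : 0 < D := by positivity
  have hlog : Real.log ν < 0 := Real.log_neg hν hν1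
  have hpow : ν ^ φ ≤ β₀ / D := by
    rw [consensusThreshold, div_le_iff_of_neg hlog] at h
    rw [← Real.log_le_log_iff (by positivity) (by positivity), Real.log_pow,
      Real.log_div hβ₀.ne' hDp.ne']
    exact h
  constructor
  · rintro rfl
    rw [pow_zero, le_div_iff₀ hDp] at hpow
    nlinarith
  · calc ν ^ φ * (n * (2 * β₀ + α * M)) ≤ β₀ / D * D := by
          refine mul_le_mul hpow (le_trans ?_ hDge) (by positivity) (by positivity)
          gcongr
          linarith
      _ = β₀ := div_mul_cancel₀ _ hDp.ne'

/-- Telescoping starts at `1` because the initial multipliers need not lie in the projection sets.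
-/
lemma neg_sum_le_of_descent {D a : ℕ → ℝ} {α c : ℝ} (hα : 0 < α) (hD : ∀ t, 0 ≤ D t)
    (h : ∀ t, 1 ≤ t → D (t + 1) ≤ D t + 2 * α * a t + c) (k : ℕ) :
    -∑ t ∈ Finset.Icc 1 k, a t ≤ (D 1 + k * c) / (2 * α) := by
  have h1 : ∀ k : ℕ, D (k + 1) ≤ D 1 + 2 * α * ∑ t ∈ Finset.Icc 1 k, a t + k * c := fun k => by
    induction k with
    | zero => simp
    | succ k ih =>
      rw [Finset.sum_Icc_succ_top (by omega)]
      have := h (k + 1) (by omega)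
      push_cast
      linarith
  rw [le_div_iff₀ (by positivity)]
  have := h1 k
  have := hD (k + 1)
  linarith

section Run

variable {n d : ℕ} {P : Problem n d} {W : Matrix (Fin n) (Fin n) ℝ} {φ : ℕ} {α R β₀ : ℝ}
  {μ : ℕ → Fin n → ℝ} {G : ℕ → Fin n → Mat d} {xt : ℕ → Fin n → ℝ}

/-- Before projection two nodes share the same mean and differ only by their two disagreements;
projections are nonexpansive. -/
lemma IsRun.norm_sub_add_norm_sub_le (hrun : IsRun P W φ α R μ G xt) {k : ℕ}
    (h : ∀ i, initialDisagreement P W φ α (μ k) (G k) (xt k) i ≤ β₀) (i j : Fin n) :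
    ‖μ (k + 1) i - μ (k + 1) j‖ + ‖G (k + 1) i - G (k + 1) j‖ ≤ 2 * β₀ := by
  have h1 := (hrun.step_μ k i).norm_sub_le (convex_Dmu R) (hrun.step_μ k j)
  have h2 := (hrun.step_G k i).norm_sub_le (convex_DG d R) (hrun.step_G k j)
  have e1 := sum_smul_eq_add_mean (W ^ φ) fun j => μ k j + α * P.g j (xt k j)
  have e2 := sum_smul_eq_add_mean (W ^ φ) fun j => G k j - α • P.localLmi j (xt k j)
  simp only [smul_eq_mul] at e1
  rw [e1 i, e1 j, add_sub_add_right_eq_sub] at h1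
  rw [e2 i, e2 j, add_sub_add_right_eq_sub] at h2
  have h3 := h1.trans (norm_sub_le _ _)
  have h4 := h2.trans (norm_sub_le _ _)
  have h5 := h i
  have h6 := h j
  unfold initialDisagreement at h5 h6
  linarith

lemma IsRun.disagreement_le (hrun : IsRun P W φ α R μ G xt) (hP : P.IsConvexCompact)
    (hα : 0 < α) {b : ℝ} (hb : ∀ i j, |(W ^ φ - avgMatrix n) i j| ≤ b)
    (hrow : ∀ i, ∑ j, (W ^ φ - avgMatrix n) i j = 0)
    (hbβ : b * (n * (2 * β₀ + α * P.boundM)) ≤ β₀)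
    (h0 : ∀ i, initialDisagreement P W φ α (μ 0) (G 0) (xt 0) i ≤ β₀) (k : ℕ) (i : Fin n) :
    initialDisagreement P W φ α (μ k) (G k) (xt k) i ≤ β₀ := by
  induction k generalizing i with
  | zero => exact h0 i
  | succ k ih =>
    have hb0 : 0 ≤ b := (abs_nonneg _).trans (hb i i)
    have h1 := norm_sum_smul_le (hb i) (hrow i)
      (fun j => μ (k + 1) j + α * P.g j (xt (k + 1) j)) (μ (k + 1) i)
    have h2 := norm_sum_smul_le (hb i) (hrow i)
      (fun j => G (k + 1) j - α • P.localLmi j (xt (k + 1) j)) (G (k + 1) i)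
    simp only [smul_eq_mul] at h1
    refine (add_le_add h1 h2).trans (le_trans ?_ hbβ)
    rw [← mul_add, ← Finset.sum_add_distrib]
    refine mul_le_mul_of_nonneg_left ?_ hb0
    have hterm : ∀ j ∈ Finset.univ, ‖μ (k + 1) j + α * P.g j (xt (k + 1) j) - μ (k + 1) i‖
        + ‖G (k + 1) j - α • P.localLmi j (xt (k + 1) j) - G (k + 1) i‖
        ≤ 2 * β₀ + α * P.boundM := fun j _ => by
      have e1 : μ (k + 1) j + α * P.g j (xt (k + 1) j) - μ (k + 1) i
          = (μ (k + 1) j - μ (k + 1) i) + α * P.g j (xt (k + 1) j) := by ring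
      have e2 : G (k + 1) j - α • P.localLmi j (xt (k + 1) j) - G (k + 1) i
          = (G (k + 1) j - G (k + 1) i) + α • (-P.localLmi j (xt (k + 1) j)) := by
        rw [smul_neg]
        abel
      have h3 := norm_add_le (μ (k + 1) j - μ (k + 1) i) (α * P.g j (xt (k + 1) j))
      have h4 := norm_add_le (G (k + 1) j - G (k + 1) i) (α • (-P.localLmi j (xt (k + 1) j)))
      rw [norm_mul, Real.norm_of_nonneg hα.le] at h3
      rw [norm_smul, Real.norm_of_nonneg hα.le] at h4
      rw [e1, e2]
      have h5 := hrun.norm_sub_add_norm_sub_le ih j i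
      have h6 := mul_le_mul_of_nonneg_left
        (P.norm_g_le_boundL hP (hrun.xt_mem (k + 1) j)) hα.le
      have h7 := mul_le_mul_of_nonneg_left
        (P.norm_neg_localLmi_le_boundQ hP (hrun.xt_mem (k + 1) j)) hα.le
      rw [Problem.boundM]
      linarith
    refine (Finset.sum_le_sum hterm).trans_eq ?_
    rw [Finset.sum_const, Finset.card_fin, nsmul_eq_mul]

lemma IsRun.norm_sub_mean_add_le (hrun : IsRun P W φ α R μ G xt) (hn : 0 < n)
    (hdis : ∀ k i, initialDisagreement P W φ α (μ k) (G k) (xt k) i ≤ β₀) {k : ℕ} (hk : 1 ≤ k)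
    (i : Fin n) : ‖μ k i - mean (μ k)‖ + ‖G k i - mean (G k)‖ ≤ 2 * β₀ := by
  obtain ⟨k, rfl⟩ := Nat.exists_eq_add_of_le' hk
  refine (add_le_add (norm_sub_mean_le hn (μ (k + 1)) i)
    (norm_sub_mean_le hn (G (k + 1)) i)).trans ?_
  rw [← mul_add, ← Finset.sum_add_distrib]
  have h0 : (n : ℝ) ≠ 0 := by positivity
  have h := Finset.sum_le_sum fun j (_ : j ∈ Finset.univ) =>
    hrun.norm_sub_add_norm_sub_le (hdis k) i j
  refine (mul_le_mul_of_nonneg_left h (by positivity)).trans_eq ?_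
  simp [h0]

/-- The local minimizers nearly minimize the Lagrangian at the averaged multipliers. -/
lemma IsRun.lagrangian_mean_le (hrun : IsRun P W φ α R μ G xt) (hn : 0 < n)
    (hP : P.IsConvexCompact)
    (hdis : ∀ k i, initialDisagreement P W φ α (μ k) (G k) (xt k) i ≤ β₀) {k : ℕ} (hk : 1 ≤ k)
    {x : Fin n → ℝ} (hx : x ∈ P.box) :
    P.lagrangian (xt k) (mean (μ k)) (mean (G k))
      ≤ P.lagrangian x (mean (μ k)) (mean (G k)) + 4 * n * β₀ * P.boundM := by
  have h : ∀ i ∈ Finset.univ, P.localLagrangian i (xt k i) (mean (μ k)) (mean (G k))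
      ≤ P.localLagrangian i (x i) (mean (μ k)) (mean (G k)) + 4 * β₀ * P.boundM := fun i _ => by
    have h1 := hrun.norm_sub_mean_add_le hn hdis hk i
    have h2 := (abs_le.mp (P.abs_localLagrangian_sub_le hP (hrun.xt_mem k i) h1)).1
    have h3 := (abs_le.mp (P.abs_localLagrangian_sub_le hP (hx i) h1)).2
    have h4 := hrun.xt_min k i (x i) (hx i)
    linarith
  rw [P.lagrangian_eq_sum hn, P.lagrangian_eq_sum hn]
  refine (Finset.sum_le_sum h).trans_eq ?_
  rw [Finset.sum_add_distrib]
  simp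
  ring

lemma IsRun.sum_dist_sq_le (hrun : IsRun P W φ α R μ G xt) (hn : 0 < n)
    (hP : P.IsConvexCompact)
    (hcol : ∀ j, ∑ i, (W ^ φ - avgMatrix n) i j = 0)
    (hdis : ∀ k i, initialDisagreement P W φ α (μ k) (G k) (xt k) i ≤ β₀) (k : ℕ)
    {m : ℝ} (hm : m ∈ Dmu R) {S : Mat d} (hS : S ∈ DG d R) :
    ∑ i, ‖μ (k + 1) i - m‖ ^ 2 + ∑ i, ‖G (k + 1) i - S‖ ^ 2
      ≤ ∑ i, ‖μ k i - m‖ ^ 2 + ∑ i, ‖G k i - S‖ ^ 2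
        + 2 * α * ((mean (μ k) - m) * P.ineq (xt k)
          - (P.lmi (xt k) * (mean (G k) - S)).trace)
        + (n * α ^ 2 * P.boundM ^ 2 + n * β₀ ^ 2) := by
  have h1 := sum_norm_proj_sub_sq_le hn (convex_Dmu R) hcol (α := α) (z := μ k)
    (s := fun j => P.g j (xt k j)) (z' := μ (k + 1))
    (fun i => by simpa only [smul_eq_mul] using hrun.step_μ k i) hm
  have h2 := sum_norm_proj_sub_sq_le hn (convex_DG d R) hcol (α := α) (z := G k)
    (s := fun j => -P.localLmi j (xt k j)) (z' := G (k + 1))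
    (fun i => by simpa only [smul_neg, ← sub_eq_add_neg] using hrun.step_G k i) hS
  have hL := norm_mean_le hn fun i => P.norm_g_le_boundL hP (hrun.xt_mem k i)
  have hQ := norm_mean_le hn fun i => P.norm_neg_localLmi_le_boundQ hP (hrun.xt_mem k i)
  have e1 : inner ℝ (∑ j, P.g j (xt k j)) (mean (μ k) - m)
      = (mean (μ k) - m) * P.ineq (xt k) := by
    simp [Problem.ineq]
  have e2 : inner ℝ (∑ j, -P.localLmi j (xt k j)) (mean (G k) - S)
      = -(P.lmi (xt k) * (mean (G k) - S)).trace := by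
    rw [Finset.sum_neg_distrib, ← P.lmi_eq_sum_localLmi hn, mat_inner_eq, Matrix.transpose_neg,
      (P.lmi_isSymm hP _).eq, Matrix.neg_mul, Matrix.trace_neg]
  rw [e1] at h1
  rw [e2] at h2
  have h3 : ∑ i, ‖∑ j, (W ^ φ - avgMatrix n) i j • (μ k j + α • P.g j (xt k j))‖ ^ 2
      + ∑ i, ‖∑ j, (W ^ φ - avgMatrix n) i j • (G k j + α • -P.localLmi j (xt k j))‖ ^ 2
      ≤ n * β₀ ^ 2 := by
    rw [← Finset.sum_add_distrib]
    have : ∑ _i : Fin n, β₀ ^ 2 = n * β₀ ^ 2 := by simp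
    rw [← this]
    refine Finset.sum_le_sum fun i _ => ?_
    have h := hdis k i
    unfold initialDisagreement at h
    simp only [smul_eq_mul, smul_neg, ← sub_eq_add_neg]
    -- `β₀` bounds the sum of the scalar and matrix parts, and `a ^ 2 + b ^ 2 ≤ (a + b) ^ 2`.
    refine le_trans ?_ (pow_le_pow_left₀ (by positivity) h 2)
    rw [add_sq]
    have := mul_nonneg (norm_nonneg (∑ j, (W ^ φ - avgMatrix n) i j *
      (μ k j + α * P.g j (xt k j)))) (norm_nonneg (∑ j, (W ^ φ - avgMatrix n) i j •
      (G k j - α • P.localLmi j (xt k j))))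
    linarith
  have h4 : ‖mean fun j => P.g j (xt k j)‖ ^ 2 + ‖mean fun j => -P.localLmi j (xt k j)‖ ^ 2
      ≤ P.boundM ^ 2 := by
    have h5 := pow_le_pow_left₀ (norm_nonneg _) hL 2
    have h6 := pow_le_pow_left₀ (norm_nonneg _) hQ 2
    have h7 := mul_nonneg ((norm_nonneg _).trans hL) ((norm_nonneg _).trans hQ)
    rw [Problem.boundM, add_sq]
    linarith
  have h5 := mul_le_mul_of_nonneg_left h4 (by positivity : (0 : ℝ) ≤ n * α ^ 2)
  linarith

end Run

/-! ### Ergodic averages and bounds on their cost -/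

lemma ergodic_eq_sum {n : ℕ} (xt : ℕ → Fin n → ℝ) (k : ℕ) :
    ergodic xt k = ∑ t ∈ Finset.Icc 1 k, (1 / (k : ℝ)) • xt t := by
  ext i
  simp [ergodic, Finset.mul_sum]

lemma ConvexOn.map_ergodic_le {n : ℕ} {F : (Fin n → ℝ) → ℝ} (hF : ConvexOn ℝ Set.univ F)
    (xt : ℕ → Fin n → ℝ) {k : ℕ} (hk : 1 ≤ k) :
    F (ergodic xt k) ≤ (1 / (k : ℝ)) * ∑ t ∈ Finset.Icc 1 k, F (xt t) := by
  have h0 : (k : ℝ) ≠ 0 := by positivity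
  have h := hF.map_sum_le (t := Finset.Icc 1 k) (w := fun _ => 1 / (k : ℝ)) (p := xt)
    (fun _ _ => by positivity) (by simp [h0]) (fun _ _ => Set.mem_univ _)
  rw [ergodic_eq_sum, Finset.mul_sum]
  exact h

lemma ergodic_mem_box {n d : ℕ} {P : Problem n d} (hP : P.IsConvexCompact)
    {xt : ℕ → Fin n → ℝ} (h : ∀ k i, xt k i ∈ P.X i) {k : ℕ} (hk : 1 ≤ k) :
    ergodic xt k ∈ P.box := by
  have h0 : (k : ℝ) ≠ 0 := by positivity
  rw [ergodic_eq_sum]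
  exact (P.convex_box hP).sum_mem (fun _ _ => by positivity) (by simp [h0]) fun t _ => h t

/-- Jensen's inequality is applied to the constraint terms only: the cost stays at the ergodic
point, where the lower bound needs it. -/
lemma Problem.lagrangian_ergodic_le {n d : ℕ} {P : Problem n d} (hP : P.IsConvexCompact)
    {m : ℝ} (hm : 0 ≤ m) (G : Mat d) (xt : ℕ → Fin n → ℝ) {k : ℕ} (hk : 1 ≤ k) :
    P.lagrangian (ergodic xt k) m G ≤ P.cost (ergodic xt k)
      + (1 / (k : ℝ)) * ∑ t ∈ Finset.Icc 1 k, (m * P.ineq (xt t) - (P.lmi (xt t) * G).trace) := by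
  have h1 := mul_le_mul_of_nonneg_left (ConvexOn.map_ergodic_le (P.convexOn_ineq hP) xt hk) hm
  have hconv : ConvexOn ℝ Set.univ fun x => -(P.lmi x * G).trace :=
    ⟨convex_univ, fun x _ y _ a b _ _ hab => by
      simp only [P.lmi_combo x y hab, Matrix.add_mul, Matrix.smul_mul, Matrix.trace_add, Matrix.trace_smul, smul_eq_mul]
      linarith⟩
  have h2 := ConvexOn.map_ergodic_le hconv xt hk
  rw [Finset.sum_neg_distrib] at h2
  rw [Finset.sum_sub_distrib, ← Finset.mul_sum]
  unfold lagrangian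
  linarith

/-- `β₀ / α ≤ τ` turns `n β₀² / (2α)` into at most `n β₀ τ / 2`, which fits under `3 n β₀ τ`;
similarly `4 n β₀ M` fits under `6 n β₀ M`. -/
lemma consensus_error_le_errorFloor {n : ℕ} {α M τ Λ Γ β₀ ζ : ℝ} (hα : 0 < α) (hM : 0 ≤ M)
    (hβ₀ : 0 < β₀) (hτ : β₀ / α ≤ τ) (hΛ : 0 ≤ Λ) (hΓ : 0 ≤ Γ) (hζ : 0 < ζ) :
    4 * n * β₀ * M + (n * α ^ 2 * M ^ 2 + n * β₀ ^ 2) / (2 * α)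
      ≤ errorFloor n α M τ Λ Γ β₀ ζ := by
  have hτ0 : 0 ≤ τ := (div_nonneg hβ₀.le hα.le).trans hτ
  have h1 : (n * α ^ 2 * M ^ 2 + n * β₀ ^ 2) / (2 * α)
      = α * n * M ^ 2 / 2 + n * β₀ * (β₀ / α) / 2 := by
    field_simp
  have h2 : n * β₀ * (β₀ / α) ≤ n * β₀ * τ := by gcongr
  have h3 : 0 ≤ n * τ * (Λ + Γ) := by positivity
  have h4 : α * n * M ^ 2 ≤ α * n * (M + τ) ^ 2 := by
    gcongr
    linarith
  have h5 : 0 ≤ n * β₀ * M := by positivity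
  have h6 : 0 ≤ n * ζ := by positivity
  have h7 : 0 ≤ n * β₀ * τ := by positivity
  rw [h1, errorFloor]
  linarith

section Bounds

variable {n d : ℕ} {P : Problem n d} {W : Matrix (Fin n) (Fin n) ℝ} {φ : ℕ} {α R β₀ : ℝ}
  {μ : ℕ → Fin n → ℝ} {G : ℕ → Fin n → Mat d} {xt : ℕ → Fin n → ℝ}

/-- The regret of the averaged multipliers against a fixed point of the projection sets. -/
lemma IsRun.average_regret_le (hrun : IsRun P W φ α R μ G xt) (hn : 0 < n)
    (hP : P.IsConvexCompact) (hα : 0 < α)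
    (hcol : ∀ j, ∑ i, (W ^ φ - avgMatrix n) i j = 0)
    (hdis : ∀ k i, initialDisagreement P W φ α (μ k) (G k) (xt k) i ≤ β₀)
    {m : ℝ} (hm : m ∈ Dmu R) {S : Mat d} (hS : S ∈ DG d R) {B : ℝ}
    (hB : ∀ i, ‖μ 1 i - m‖ ^ 2 + ‖G 1 i - S‖ ^ 2 ≤ B) {k : ℕ} (hk : 1 ≤ k) :
    -((1 / (k : ℝ)) * ∑ t ∈ Finset.Icc 1 k, ((mean (μ t) - m) * P.ineq (xt t)
          - (P.lmi (xt t) * (mean (G t) - S)).trace))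
      ≤ B / (2 * k * α / n) + (n * α ^ 2 * P.boundM ^ 2 + n * β₀ ^ 2) / (2 * α) := by
  have hn0 : (0 : ℝ) < n := by positivity
  have hk0 : (0 : ℝ) < k := by positivity
  have h := neg_sum_le_of_descent hα
    (D := fun t => ∑ i, ‖μ t i - m‖ ^ 2 + ∑ i, ‖G t i - S‖ ^ 2)
    (fun t => by positivity) (fun t _ => hrun.sum_dist_sq_le hn hP hcol hdis t hm hS) k
  have h1 : ∑ i, ‖μ 1 i - m‖ ^ 2 + ∑ i, ‖G 1 i - S‖ ^ 2 ≤ n * B := by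
    rw [← Finset.sum_add_distrib]
    refine (Finset.sum_le_sum fun i _ => hB i).trans_eq ?_
    simp
  rw [← mul_neg]
  refine (mul_le_mul_of_nonneg_left (h.trans (div_le_div_of_nonneg_right
    (add_le_add_left h1 _) (by positivity))) (by positivity)).trans_eq ?_
  field_simp

/-- Upper bound on the cost of the ergodic iterate. -/
lemma IsRun.cost_ergodic_le (hrun : IsRun P W φ α R μ G xt) (hn : 0 < n)
    (hP : P.IsConvexCompact) (hα : 0 < α)
    (hcol : ∀ j, ∑ i, (W ^ φ - avgMatrix n) i j = 0)
    (hdis : ∀ k i, initialDisagreement P W φ α (μ k) (G k) (xt k) i ≤ β₀) {B : ℝ}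
    (hB : ∀ i, ‖μ 1 i‖ ^ 2 + ‖G 1 i‖ ^ 2 ≤ B) {k : ℕ} (hk : 1 ≤ k)
    {x : Fin n → ℝ} (hx : x ∈ P.feasible) :
    P.cost (ergodic xt k) ≤ P.cost x + B / (2 * k * α / n)
      + (4 * n * β₀ * P.boundM
        + (n * α ^ 2 * P.boundM ^ 2 + n * β₀ ^ 2) / (2 * α)) := by
  have hk0 : (k : ℝ) ≠ 0 := by positivity
  have hR : 0 ≤ R := (norm_nonneg _).trans (hrun.step_μ 0 ⟨0, hn⟩).1.2
  have h0 := hrun.average_regret_le hn hP hα hcol hdis (m := 0) ⟨le_rfl, by simpa using hR⟩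
    (S := 0) ⟨Matrix.PosSemidef.zero, by simpa using hR⟩ (B := B) (by simpa using hB) hk
  have h1 := ConvexOn.map_ergodic_le (P.convexOn_cost hP) xt hk
  have h2 : ∑ t ∈ Finset.Icc 1 k, P.cost (xt t)
      ≤ ∑ t ∈ Finset.Icc 1 k, ((P.cost x + 4 * n * β₀ * P.boundM)
        - ((mean (μ t) - 0) * P.ineq (xt t)
          - (P.lmi (xt t) * (mean (G t) - 0)).trace)) := by
    refine Finset.sum_le_sum fun t ht => ?_
    have ht1 := (Finset.mem_Icc.mp ht).1
    obtain ⟨s, rfl⟩ := Nat.exists_eq_add_of_le' ht1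
    have h3 := hrun.lagrangian_mean_le hn hP hdis ht1 hx.1
    have h4 := P.lagrangian_le_cost hx
      (mean_mem hn (convex_Dmu R) fun i => (hrun.step_μ s i).1).1
      (mean_mem hn (convex_DG d R) fun i => (hrun.step_G s i).1).1
    have h5 := h3.trans (add_le_add_left h4 _)
    rw [Problem.lagrangian] at h5
    rw [sub_zero, sub_zero]
    linarith
  have h3 := mul_le_mul_of_nonneg_left h2 (by positivity : (0 : ℝ) ≤ 1 / k)
  rw [Finset.sum_sub_distrib, mul_sub, Finset.sum_const, Nat.card_Icc, nsmul_eq_mul,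
    Nat.add_sub_cancel, ← mul_assoc, one_div_mul_cancel hk0, one_mul] at h3
  linarith

/-- Lower bound on the cost of the ergodic iterate, given an optimal multiplier whose double lies
in the projection sets. -/
lemma IsRun.le_cost_ergodic (hrun : IsRun P W φ α R μ G xt) (hn : 0 < n)
    (hP : P.IsConvexCompact) (hα : 0 < α)
    (hcol : ∀ j, ∑ i, (W ^ φ - avgMatrix n) i j = 0)
    (hdis : ∀ k i, initialDisagreement P W φ α (μ k) (G k) (xt k) i ≤ β₀)
    {xbar : Fin n → ℝ} (hxbar : P.IsSlater xbar) {m : ℝ} {S : Mat d} (hm : 0 ≤ m)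
    (hopt : ∀ x ∈ P.box, P.optValue ≤ P.lagrangian x m S)
    (hm2 : 2 * m ∈ Dmu R) (hS2 : (2 : ℝ) • S ∈ DG d R) {B : ℝ}
    (hB : ∀ i, ‖μ 1 i - 2 * m‖ ^ 2 + ‖G 1 i - (2 : ℝ) • S‖ ^ 2 ≤ B) {k : ℕ} (hk : 1 ≤ k) :
    P.optValue - B / (2 * k * α / n)
      - (4 * n * β₀ * P.boundM
        + (n * α ^ 2 * P.boundM ^ 2 + n * β₀ ^ 2) / (2 * α)) ≤ P.cost (ergodic xt k) := by
  have hk0 : (k : ℝ) ≠ 0 := by positivity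
  have h0 := hrun.average_regret_le hn hP hα hcol hdis hm2 hS2 hB hk
  have h1 := (hopt _ (ergodic_mem_box hP hrun.xt_mem hk)).trans
    (P.lagrangian_ergodic_le hP hm S xt hk)
  have h2 : ∑ t ∈ Finset.Icc 1 k, (m * P.ineq (xt t) - (P.lmi (xt t) * S).trace)
      ≤ ∑ t ∈ Finset.Icc 1 k, (4 * n * β₀ * P.boundM
        - ((mean (μ t) - 2 * m) * P.ineq (xt t)
          - (P.lmi (xt t) * (mean (G t) - (2 : ℝ) • S)).trace)) := by
    refine Finset.sum_le_sum fun t ht => ?_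
    have ht1 := (Finset.mem_Icc.mp ht).1
    obtain ⟨s, rfl⟩ := Nat.exists_eq_add_of_le' ht1
    have h3 : P.lagrangian (xt (s + 1)) (mean (μ (s + 1))) (mean (G (s + 1)))
        - 4 * n * β₀ * P.boundM ≤ P.optValue := P.le_optValue hxbar fun x hx => by
      have h4 := hrun.lagrangian_mean_le hn hP hdis ht1 hx.1
      have h5 := P.lagrangian_le_cost hx
        (mean_mem hn (convex_Dmu R) fun i => (hrun.step_μ s i).1).1
        (mean_mem hn (convex_DG d R) fun i => (hrun.step_G s i).1).1
      have h6 := h4.trans (add_le_add_left h5 _)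
      linarith
    -- Subtracting this from `h3` cancels the cost and leaves the pairing of the constraint values
    -- with `z_t - z*`, bounded by the Lagrangian error.
    have h4 := hopt _ (hrun.xt_mem (s + 1))
    rw [Problem.lagrangian] at h3 h4
    rw [Matrix.mul_sub, Matrix.trace_sub, Matrix.mul_smul, Matrix.trace_smul, smul_eq_mul]
    linarith
  have h3 := mul_le_mul_of_nonneg_left (h2.trans_eq (Finset.sum_sub_distrib
    (fun _ => 4 * n * β₀ * P.boundM) _)) (by positivity : (0 : ℝ) ≤ 1 / k)
  rw [mul_sub, Finset.sum_const, Nat.card_Icc, nsmul_eq_mul,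
    Nat.add_sub_cancel, ← mul_assoc, one_div_mul_cancel hk0, one_mul] at h3
  linarith

end Bounds

end CoBaDD

end

theorem theorem3 (n d : ℕ) (hn : 0 < n) (hd : 0 < d)
    (P : CoBaDD.Problem n d) (hP : P.IsConvexCompact)
    (N : SimpleGraph (Fin n)) (W : Matrix (Fin n) (Fin n) ℝ) (ν : ℝ) (hν : 0 < ν)
    (hW : CoBaDD.IsConsensusMatrix N W ν)
    (xbar : Fin n → ℝ) (hxbar : P.IsSlater xbar)
    (μt : ℝ) (hμt : 0 ≤ μt) (Gt : CoBaDD.Mat d) (hGt : Gt.PosSemidef)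
    (r : ℝ) (hr : 0 < r) (hr' : P.dualBound xbar μt Gt ≤ r)
    (R : ℝ) (hR : R = P.dualBound xbar μt Gt + r)
    (α : ℝ) (hα : 0 < α) (φ : ℕ)
    (μ : ℕ → Fin n → ℝ) (G : ℕ → Fin n → CoBaDD.Mat d) (xt : ℕ → Fin n → ℝ)
    (hrun : CoBaDD.IsRun P W φ α R μ G xt)
    (β₀ : ℝ) (hβ₀ : 0 < β₀)
    (hβ₀' : ∀ i, CoBaDD.initialDisagreement P W φ α (μ 0) (G 0) (xt 0) i ≤ β₀)
    (δ : ℝ) (hδ : 0 ≤ δ)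
    (hφ : CoBaDD.consensusThreshold n d ν α P.boundM β₀ + δ ≤ φ)
    (Λ Γ : ℝ) (hΛ : ∀ m ∈ CoBaDD.Dmu R, ‖m‖ ≤ Λ)
    (hΓ : ∀ S ∈ CoBaDD.DG d R, ‖S‖ ≤ Γ)
    (τ : ℝ) (hτ : β₀ / α ≤ τ)
    (ζ : ℝ) (hζ : 0 < ζ)
    (hζ' : CoBaDD.IsPerturbationBound (CoBaDD.Dmu R ×ˢ CoBaDD.DG d R)
      (fun z => P.dual z.1 z.2) τ ζ)
    (k : ℕ) (hk : 1 ≤ k) :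
    P.cost (CoBaDD.ergodic xt k) ≤ P.optValue + (Λ ^ 2 + Γ ^ 2) / (2 * k * α / n)
        + CoBaDD.errorFloor n α P.boundM τ Λ Γ β₀ ζ ∧
    P.optValue - 9 * (Λ ^ 2 + Γ ^ 2) / (2 * k * α / n)
        - CoBaDD.errorFloor n α P.boundM τ Λ Γ β₀ ζ ≤ P.cost (CoBaDD.ergodic xt k) := by
  have hM : 0 ≤ P.boundM :=
    add_nonneg ((norm_nonneg _).trans (P.norm_g_le_boundL hP (hxbar.1 ⟨0, hn⟩)))
      ((norm_nonneg _).trans (P.norm_neg_localLmi_le_boundQ hP (hxbar.1 ⟨0, hn⟩)))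
  obtain ⟨hφ0, hpow⟩ := CoBaDD.pow_le_of_consensusThreshold_le (d := d) hn hν hW.ν_lt_one hα hM
    hβ₀ ((le_add_of_nonneg_right hδ).trans hφ)
  have hent : ∀ i j, |(W ^ φ - CoBaDD.avgMatrix n) i j| ≤ ν ^ φ := fun i j => by
    rw [CoBaDD.pow_sub_avgMatrix hn hW.symm hW.mulVec_one hφ0]
    exact CoBaDD.abs_pow_apply_le_of_spectralRadius_le hν.le
      (hW.symm.sub (CoBaDD.avgMatrix_isSymm n)) hW.radius_le φ i j
  have hcol := CoBaDD.sum_pow_sub_avgMatrix_col hn hW.symm hW.mulVec_one φ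
  have hdis := hrun.disagreement_le hP hα hent
    (CoBaDD.sum_pow_sub_avgMatrix_row hn hW.mulVec_one φ) hpow hβ₀'
  have hμ1 : ∀ i, ‖μ 1 i‖ ≤ Λ := fun i => hΛ _ (hrun.step_μ 0 i).1
  have hG1 : ∀ i, ‖G 1 i‖ ≤ Γ := fun i => hΓ _ (hrun.step_G 0 i).1
  have hΛ0 : 0 ≤ Λ := (norm_nonneg _).trans (hμ1 ⟨0, hn⟩)
  have hΓ0 : 0 ≤ Γ := (norm_nonneg _).trans (hG1 ⟨0, hn⟩)
  have herr := CoBaDD.consensus_error_le_errorFloor (n := n) hα hM hβ₀ hτ hΛ0 hΓ0 hζ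
  constructor
  · have h := P.le_optValue hxbar fun x hx => sub_le_iff_le_add.mpr
      ((hrun.cost_ergodic_le hn hP hα hcol hdis (fun i => add_le_add
        (pow_le_pow_left₀ (norm_nonneg _) (hμ1 i) 2) (pow_le_pow_left₀ (norm_nonneg _) (hG1 i) 2))
        hk hx).trans_eq (add_assoc _ _ _))
    linarith
  · obtain ⟨m, S, hm, hS, hopt⟩ := P.exists_dual_optimal hd hP hxbar
    have hb := P.add_norm_le_dualBound hn hd hP hxbar hμt hGt hm hS hopt
    -- `m + ‖S‖` is at most `dualBound`, which is at most `r`, so doubling stays within `R =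
    -- dualBound + r`.
    have hm2 : 2 * m ∈ CoBaDD.Dmu R := by
      refine ⟨by positivity, ?_⟩
      rw [Real.norm_of_nonneg (by positivity)]
      linarith [norm_nonneg S]
    have hS2 := CoBaDD.two_smul_mem_DG (R := R) hS (by linarith)
    have h := hrun.le_cost_ergodic hn hP hα hcol hdis hxbar hm hopt hm2 hS2
      -- Both points lie in the projection sets, so the distances are at most `2 * Λ` and `2 * Γ`;
      -- the factor `4` would already suffice.
      (B := 9 * (Λ ^ 2 + Γ ^ 2)) (fun i => by
        have h1 : ‖μ 1 i - 2 * m‖ ≤ 2 * Λ := (norm_sub_le _ _).trans (by linarith [hμ1 i, hΛ _ hm2])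
        have h2 : ‖G 1 i - (2 : ℝ) • S‖ ≤ 2 * Γ :=
          (norm_sub_le _ _).trans (by linarith [hG1 i, hΓ _ hS2])
        have h3 := pow_le_pow_left₀ (norm_nonneg _) h1 2
        have h4 := pow_le_pow_left₀ (norm_nonneg _) h2 2
        nlinarith [sq_nonneg Λ, sq_nonneg Γ]) hk
    linarith
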